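/- Let $M$ be an oriented smooth surface with boundary and corners (for instance a closed disc), with a finite smooth triangulation $\mathcal T$: finitely many closed triangles $T$ cover $M$, each is the image of the standard simplex $\hat T$ under an orientation-preserving diffeomorphism, and two different triangles meet in a common proper face or not at all. A Regge metric $g$ on $(M,\mathcal T)$ consists of a Riemannian metric on each closed triangle, smooth up to its boundary, such that the metrics induced on a common edge by the two triangles containing it agree. For a Regge metric $g$ and a triangle $T$ let $K$ be the Gauss curvature and $dA$ the area form on $T$; let $n$ be the outward unit normal along an edge of $T$, $\tau$ the unit tangent in the orientation of $\partial T$, $ds$ the arclength, $k=-\langle\nabla_\tau\tau,n\rangle$ the geodesic curvature, and $\theta_T(p)$ the interior angle of $T$ at its vertex $p$; all are measured by $g|_T$. For an edge $e$, $[[k\,ds]]$ is the sum of $k\,ds$ over the (one or two) triangles that contain $e$, and $dv([[n]])$ is the sum of $d(v|_T)(n)$ over these triangles. Let $e_1$ be a unit vector field along the edges of $\partial M$ and let $\mu$ be the angle from $e_1$ to the outward normal, $e_1=\cos\mu\,n-\sin\mu\,\tau$, given by a real-valued $C^1$ branch on each boundary edge. At a boundary vertex $p$ let $[[\mu]]|_p$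 be the value of $\mu$ at $p$ on the boundary edge that starts at $p$ minus the value on the boundary edge that ends at $p$, in the boundary orientation. For $v:M\to\mathbb R$ put \[ \langle\langle KdA_{\mathrm{dist}}(g),v\rangle\rangle=\sum_{T}\int_T vK\,dA+\sum_{e\not\subset\partial M}\int_e v[[k\,ds]]+\sum_{p\notin\partial M}v(p)\Bigl(2\pi-\sum_{T\ni p}\theta_T(p)\Bigr), \] \[ \langle\langle\alpha_{\mathrm{dist}}(g),v\rangle\rangle=\sum_{e\subset\partial M}\int_e v(d\mu-k\,ds)-\sum_{p\in\partial M}v(p)\Bigl(\pi-[[\mu]]|_p-\sum_{T\ni p}\theta_T(p)\Bigr), \] \[ b_h(g;\sigma,v)=\sum_{T}\int_T\langle\mathbb S\sigma,\nabla\nabla v\rangle\,dA-\sum_{e}\int_e(\mathbb S\sigma)(n,n)\,dv([[n]])\,ds,\qquad \mathbb S\sigma=\sigma-\mathrm{tr}_g(\sigma)\,g, \] where $T$, $e$, $p$ run over the triangles, edges and vertices of $\mathcal T$, and $\sigma$ is a symmetric bilinear form on each triangle whose tangential-tangential components agree on common edges (so that $(\mathbb S\sigma)(n,n)=-\sigma(\tau,\tau)$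 is the same from both sides of an edge). Theorem. Let $v:M\to\mathbb R$ be such that $v|_T\in C^2(T)$ for every closed triangle $T$, and let $g(t)$, $t\in[0,1]$, be a family of Regge metrics on $(M,\mathcal T)$ such that on each closed triangle $T$ the metric $g(t)|_T$ depends smoothly on $t$ (its coefficients are smooth in $(t,x)\in[0,1]\times T$). Suppose that the unit field $e_1(t)$ along $\partial M$ evolves so that its angle $\mu$ with the outward normal, measured by $g(t)$, does not depend on $t$. Then, for every $t\in[0,1]$ (with one-sided derivatives at $0$ and $1$), the derivative below exists and \[ \frac{\partial}{\partial t}\Bigl[\langle\langle\alpha_{\mathrm{dist}}(g(t)),v\rangle\rangle-\langle\langle KdA_{\mathrm{dist}}(g(t)),v\rangle\rangle\Bigr]=-\frac12\,b_h(g(t);\dot g(t),v). \] -/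

import Mathlib

open scoped Manifold ContDiff Matrix

noncomputable section

namespace Regge

/-! ### The reference triangle -/

/-- Coordinates on the reference triangle. -/
abbrev Coord : Type := Fin 2 → ℝ

/-- The standard closed `2`-simplex. -/
def refTriangle : Set Coord := {x | 0 ≤ x 0 ∧ 0 ≤ x 1 ∧ x 0 + x 1 ≤ 1}

/-- Its vertices, in counterclockwise order. -/
def refVertex : Fin 3 → Coord := ![![0, 0], ![1, 0], ![0, 1]]

/-- Its faces: the face spanned by a set of vertices (`∅` spans the empty set). -/
def refFace (s : Finset (Fin 3)) : Set Coord := convexHull ℝ (refVertex '' (s : Set (Fin 3)))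

/-- The direction of the `k`-th side, which runs from vertex `k` to vertex `k + 1`. -/
def sideDir (k : Fin 3) : Coord := refVertex (k + 1) - refVertex k

/-- The counterclockwise parametrization of the `k`-th side by `s ∈ [0,1]`. -/
def sidePt (k : Fin 3) (s : ℝ) : Coord := refVertex k + s • sideDir k

/-- The covector that annihilates the `k`-th side and is positive on outward vectors
(the direction of the side, rotated clockwise by a right angle). -/
def sideConormal (k : Fin 3) : Coord := ![sideDir k 1, -sideDir k 0]

/-! ### Riemannian geometry on the reference triangle

`G` is the matrix of a Riemannian metric in the coordinates of the reference triangle, and `w` is a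
function in these coordinates. All derivatives are taken within the closed triangle, hence are
one-sided on its boundary. -/

/-- A field of bilinear forms in coordinates. -/
abbrev MatField : Type := Coord → Matrix (Fin 2) (Fin 2) ℝ

/-- The partial derivative `∂_a w`. -/
def partialD (a : Fin 2) (w : Coord → ℝ) (x : Coord) : ℝ :=
  fderivWithin ℝ w refTriangle x (Pi.single a 1)

/-- The value of a bilinear form with matrix `A` on two vectors. -/
def form (A : Matrix (Fin 2) (Fin 2) ℝ) (u w : Coord) : ℝ := u ⬝ᵥ (A *ᵥ w)

/-- The Christoffel symbol `Γ^c_{ab}` of the Levi-Civita connection. -/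
def christoffel (G : MatField) (c a b : Fin 2) (x : Coord) : ℝ :=
  (1 / 2) * ∑ d, (G x)⁻¹ c d *
    (partialD a (fun y => G y b d) x + partialD b (fun y => G y a d) x
      - partialD d (fun y => G y a b) x)

/-- The curvature coefficients: `R(∂_a, ∂_b) ∂_c = ∑_d R^d_{cab} ∂_d`, with
`R(X, Y) = ∇_X ∇_Y - ∇_Y ∇_X - ∇_{[X, Y]}`. -/
def riemann (G : MatField) (d c a b : Fin 2) (x : Coord) : ℝ :=
  partialD a (christoffel G d b c) x - partialD b (christoffel G d a c) x
    + ∑ e, (christoffel G d a e x * christoffel G e b c x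
      - christoffel G d b e x * christoffel G e a c x)

/-- The Gauss curvature `⟨R(∂₀, ∂₁) ∂₁, ∂₀⟩ / det G`. -/
def gaussCurv (G : MatField) (x : Coord) : ℝ :=
  (∑ d, G x 0 d * riemann G d 1 0 1 x) / (G x).det

/-- The density of the area form `dA` with respect to Lebesgue measure. -/
def areaDensity (G : MatField) (x : Coord) : ℝ := √(G x).det

/-- The covariant Hessian `∇∇w`. -/
def hessian (G : MatField) (w : Coord → ℝ) (x : Coord) : Matrix (Fin 2) (Fin 2) ℝ :=
  Matrix.of fun a b =>
    partialD a (partialD b w) x - ∑ c, christoffel G c a b x * partialD c w x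

/-- The inner product that the metric induces on bilinear forms,
`⟨A, B⟩ = G^{ac} G^{bd} A_{ab} B_{cd}`. -/
def tensorInner (Gx A B : Matrix (Fin 2) (Fin 2) ℝ) : ℝ :=
  ∑ a, ∑ b, ∑ c, ∑ d, Gx⁻¹ a c * Gx⁻¹ b d * A a b * B c d

/-- The metric trace `G^{ab} A_{ab}`. -/
def metricTrace (Gx A : Matrix (Fin 2) (Fin 2) ℝ) : ℝ := ∑ a, ∑ b, Gx⁻¹ a b * A a b

/-- `𝕊σ = σ - tr(σ) g`. -/
def opS (Gx A : Matrix (Fin 2) (Fin 2) ℝ) : Matrix (Fin 2) (Fin 2) ℝ :=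
  A - metricTrace Gx A • Gx

/-- The length of the velocity of `sidePt k` at the point with metric matrix `Gx`; the length
element of the side is `ds = sideSpeed ds'` with `s'` the parameter. -/
def sideSpeed (Gx : Matrix (Fin 2) (Fin 2) ℝ) (k : Fin 3) : ℝ :=
  √(form Gx (sideDir k) (sideDir k))

/-- The unit tangent `τ` of the `k`-th side, in counterclockwise direction. -/
def unitTangent (Gx : Matrix (Fin 2) (Fin 2) ℝ) (k : Fin 3) : Coord :=
  (sideSpeed Gx k)⁻¹ • sideDir k

/-- The outward unit normal `n` of the `k`-th side: the normalization of the outward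
conormal with its index raised by the metric. -/
def unitNormal (Gx : Matrix (Fin 2) (Fin 2) ℝ) (k : Fin 3) : Coord :=
  (√(form Gx⁻¹ (sideConormal k) (sideConormal k)))⁻¹ • (Gx⁻¹ *ᵥ sideConormal k)

/-- The geodesic curvature of the `k`-th side at a point `x` of it, as part of the boundary of the
triangle: `⟨∇_{γ'} γ', -n⟩ / |γ'|²` for `γ = sidePt k`, whose coordinate acceleration vanishes.
It is positive where the triangle is convex. -/
def geodCurv (G : MatField) (k : Fin 3) (x : Coord) : ℝ :=
  form (G x) (fun c => ∑ a, ∑ b, christoffel G c a b x * sideDir k a * sideDir k b)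
    (-unitNormal (G x) k) / sideSpeed (G x) k ^ 2

/-- The interior angle at vertex `k`, between the outgoing side `k` and the reversed
incoming side `k - 1` (that is, `k + 2`). -/
def interiorAngle (G : MatField) (k : Fin 3) : ℝ :=
  Real.arccos (form (G (refVertex k)) (unitTangent (G (refVertex k)) k)
    (-unitTangent (G (refVertex k)) (k + 2)))

/-! ### Oriented surfaces with corners and their triangulations -/

/-- The model of surfaces with boundary and corners: the quadrant in the plane. -/
abbrev modelI : ModelWithCorners ℝ (EuclideanSpace ℝ (Fin 2)) (EuclideanQuadrant 2) :=
  modelWithCornersEuclideanQuadrant 2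

variable {M : Type*} [TopologicalSpace M] [ChartedSpace (EuclideanQuadrant 2) M]

/-- The determinant of two tangent vectors in the preferred chart at the point. -/
def tangentDet (x : M) (u w : TangentSpace modelI x) : ℝ :=
  let u' : EuclideanSpace ℝ (Fin 2) := u
  let w' : EuclideanSpace ℝ (Fin 2) := w
  u' 0 * w' 1 - u' 1 * w' 0

variable (M) in
/-- An orientation of a surface: `sign x` tells whether the preferred chart at `x` is positively or
negatively oriented at `x`, and these choices are locally consistent. -/
structure SurfaceOrientation [IsManifold modelI ∞ M] where
  sign : M → ℤˣ
  consistent : ∀ x₀ : M, ∀ᶠ x in nhds x₀,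
    0 < ((sign x : ℤ) : ℝ) * ((sign x₀ : ℤ) : ℝ) *
      (tangentCoordChange modelI x x₀ x).toLinearMap.det

/-- The differential of a map from the reference triangle to the surface. -/
def diffMap (f : Coord → M) (x : Coord) :
    TangentSpace 𝓘(ℝ, Coord) x →L[ℝ] TangentSpace modelI (f x) :=
  mfderivWithin 𝓘(ℝ, Coord) modelI f refTriangle x

/-- A finite smooth triangulation of an oriented surface. Each triangle is given with an
orientation-preserving diffeomorphism `param i` from the reference triangle onto it; the edges and
vertices are those of the triangles. -/
structure Triangulation [IsManifold modelI ∞ M] (o : SurfaceOrientation M)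
    (ι : Type*) [Fintype ι] where
  param : ι → Coord → M
  smooth : ∀ i, ContMDiffOn 𝓘(ℝ, Coord) modelI ∞ (param i) refTriangle
  injOn : ∀ i, Set.InjOn (param i) refTriangle
  orientation_preserving : ∀ i, ∀ x ∈ refTriangle,
    0 < ((o.sign (param i x) : ℤ) : ℝ) *
      tangentDet (param i x) (diffMap (param i) x (Pi.single 0 1 : Coord))
        (diffMap (param i) x (Pi.single 1 1 : Coord))
  cover : ⋃ i, param i '' refTriangle = Set.univ
  /-- Two different triangles meet in a common proper face, possibly empty. -/
  inter : ∀ i j, i ≠ j → ∃ s s' : Finset (Fin 3), s ≠ Finset.univ ∧ s' ≠ Finset.univ ∧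
    param i '' refTriangle ∩ param j '' refTriangle = param i '' refFace s ∧
    param i '' refFace s = param j '' refFace s'

namespace Triangulation

variable [IsManifold modelI ∞ M] {o : SurfaceOrientation M} {ι : Type*} [Fintype ι]
variable (𝒯 : Triangulation o ι)

/-- The `k`-th edge of the `i`-th triangle, as a subset of the surface. -/
def edge (i : ι) (k : Fin 3) : Set M := 𝒯.param i '' (sidePt k '' Set.Icc 0 1)

/-- The `k`-th vertex of the `i`-th triangle. -/
def vertex (i : ι) (k : Fin 3) : M := 𝒯.param i (refVertex k)

open Classical in
/-- The edges of the triangulation. -/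
def edges : Finset (Set M) := Finset.univ.image fun q : ι × Fin 3 => 𝒯.edge q.1 q.2

open Classical in
/-- The vertices of the triangulation. -/
def vertices : Finset M := Finset.univ.image fun q : ι × Fin 3 => 𝒯.vertex q.1 q.2

open Classical in
/-- The sum of `X` over the triangles that contain the edge `e`: a sum of two terms for an interior
edge and of one term for a boundary edge. With `X i k` an integral over the `k`-th edge of
triangle `i` in the orientation induced by that triangle, or with an integrand that depends on its
outward normal, this is the integral over `e` of the jump. -/
def edgeSum (X : ι → Fin 3 → ℝ) (e : Set M) : ℝ :=
  ∑ i, ∑ k, if 𝒯.edge i k = e then X i k else 0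

open Classical in
/-- The sum of `X` over the triangles that contain the vertex `p`. -/
def vertexSum (X : ι → Fin 3 → ℝ) (p : M) : ℝ :=
  ∑ i, ∑ k, if 𝒯.vertex i k = p then X i k else 0

/-- The edge lies in the boundary of the surface. -/
def IsBoundarySide (i : ι) (k : Fin 3) : Prop := 𝒯.edge i k ⊆ ModelWithCorners.boundary (I := modelI) M

/-! ### Regge metrics -/

variable (M ι) in
/-- For each triangle a field of functions of two tangent vectors (a bilinear form in all uses). -/
abbrev PiecewiseForm : Type _ :=
  ι → (x : M) → TangentSpace modelI x → TangentSpace modelI x → ℝ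

/-- The matrix of the `i`-th field in the coordinates of the `i`-th triangle. -/
def matrixOf (σ : PiecewiseForm M ι) (i : ι) : MatField := fun x => Matrix.of fun a b =>
  σ i (𝒯.param i x) (diffMap (𝒯.param i) x (Pi.single a 1 : Coord))
    (diffMap (𝒯.param i) x (Pi.single b 1 : Coord))

/-- A Regge metric: a smooth Riemannian metric on each closed triangle, such that the metrics
that two triangles induce on a common edge agree. -/
structure ReggeMetric where
  form : ι → (x : M) → TangentSpace modelI x →ₗ[ℝ] TangentSpace modelI x →ₗ[ℝ] ℝ
  symm : ∀ i, ∀ x ∈ 𝒯.param i '' refTriangle, ∀ u w, form i x u w = form i x w u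
  pos : ∀ i, ∀ x ∈ 𝒯.param i '' refTriangle, ∀ u, u ≠ 0 → 0 < form i x u u
  smooth : ∀ i a b, ContDiffOn ℝ ∞
    (fun x => 𝒯.matrixOf (fun j y u w => form j y u w) i x a b) refTriangle
  compat : ∀ i j k l, 𝒯.edge i k = 𝒯.edge j l → ∀ s ∈ Set.Icc (0 : ℝ) 1,
    form i (𝒯.param i (sidePt k s)) (diffMap (𝒯.param i) (sidePt k s) (sideDir k))
        (diffMap (𝒯.param i) (sidePt k s) (sideDir k))
      = form j (𝒯.param i (sidePt k s)) (diffMap (𝒯.param i) (sidePt k s) (sideDir k))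
        (diffMap (𝒯.param i) (sidePt k s) (sideDir k))

variable {𝒯}

/-- The matrix of the metric in the coordinates of the `i`-th triangle. -/
def ReggeMetric.mat (g : 𝒯.ReggeMetric) (i : ι) : MatField :=
  𝒯.matrixOf (fun j y u w => g.form j y u w) i

/-- The family `g t`, `t ∈ [0,1]`, is smooth on each triangle: its coefficients are smooth functions
of the parameter and the point, up to the boundary. -/
def SmoothFamily (g : ℝ → 𝒯.ReggeMetric) : Prop :=
  ∀ i a b, ContDiffOn ℝ ∞ (fun q : ℝ × Coord => (g q.1).mat i q.2 a b)
    (Set.Icc 0 1 ×ˢ refTriangle)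

/-- The derivative of the family with respect to the parameter (one-sided at `0` and `1`). -/
def familyDeriv (g : ℝ → 𝒯.ReggeMetric) (t : ℝ) : PiecewiseForm M ι :=
  fun i x u w => derivWithin (fun s => (g s).form i x u w) (Set.Icc 0 1) t

variable (𝒯)

/-- `v` is of class `C²` on each closed triangle. -/
def PiecewiseC2 (v : M → ℝ) : Prop :=
  ∀ i, ContDiffOn ℝ 2 (v ∘ 𝒯.param i) refTriangle

variable {𝒯}

/-- `μ` is the angle that the unit vector field `e₁` makes with the outward normal along the
boundary, measured by `g`: on the `k`-th edge of triangle `i`, if it is a boundary edge, `μ i k` is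
a branch of the oriented angle from `e₁` to the outward unit normal `n`, that is
`e₁ = cos μ n - sin μ τ` for the positively oriented orthonormal frame `(n, τ)`. -/
def IsBoundaryAngle (g : 𝒯.ReggeMetric)
    (e₁ : (i : ι) → (k : Fin 3) → (s : ℝ) → TangentSpace modelI (𝒯.param i (sidePt k s)))
    (μ : ι → Fin 3 → ℝ → ℝ) : Prop :=
  ∀ i k, 𝒯.IsBoundarySide i k → ∀ s ∈ Set.Icc (0 : ℝ) 1,
    e₁ i k s = diffMap (𝒯.param i) (sidePt k s)
      (Real.cos (μ i k s) • unitNormal (g.mat i (sidePt k s)) k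
        - Real.sin (μ i k s) • unitTangent (g.mat i (sidePt k s)) k : Coord)

/-- `∫_e v k ds` over the `k`-th edge of triangle `i`, with the geodesic curvature of that edge in
the boundary of that triangle. -/
def curvIntegral (g : 𝒯.ReggeMetric) (v : M → ℝ) (i : ι) (k : Fin 3) : ℝ :=
  ∫ s in (0 : ℝ)..1, v (𝒯.param i (sidePt k s)) * geodCurv (g.mat i) k (sidePt k s) *
    sideSpeed (g.mat i (sidePt k s)) k

/-- `∑_{T ∋ p} θ_T(p)`. -/
def angleSum (g : 𝒯.ReggeMetric) (p : M) : ℝ :=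
  𝒯.vertexSum (fun i k => interiorAngle (g.mat i) k) p

open Classical in
/-- The distributional Gaussian curvature `⟨⟨KdA_dist(g), v⟩⟩`. -/
def curvDist (g : 𝒯.ReggeMetric) (v : M → ℝ) : ℝ :=
  (∑ i, ∫ x in refTriangle,
      v (𝒯.param i x) * gaussCurv (g.mat i) x * areaDensity (g.mat i) x)
    + (∑ e ∈ 𝒯.edges with ¬ e ⊆ ModelWithCorners.boundary (I := modelI) M,
        𝒯.edgeSum (curvIntegral g v) e)
    + ∑ p ∈ 𝒯.vertices with p ∉ ModelWithCorners.boundary (I := modelI) M,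
        v p * (2 * Real.pi - angleSum g p)

variable (𝒯) in
open Classical in
/-- The jump `[[μ]]|_p` at a boundary vertex: the value at `p` on the boundary edge that starts
there minus the value on the boundary edge that ends there, in the boundary orientation. -/
def angleJump (μ : ι → Fin 3 → ℝ → ℝ) (p : M) : ℝ :=
  (∑ i, ∑ k, if 𝒯.IsBoundarySide i k ∧ 𝒯.vertex i k = p then μ i k 0 else 0)
    - ∑ i, ∑ k, if 𝒯.IsBoundarySide i k ∧ 𝒯.vertex i (k + 1) = p then μ i k 1 else 0

open Classical in
/-- The distributional boundary connection term `⟨⟨α_dist(g), v⟩⟩` with boundary angle `μ`. -/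
def connDist (g : 𝒯.ReggeMetric) (μ : ι → Fin 3 → ℝ → ℝ) (v : M → ℝ) : ℝ :=
  (∑ e ∈ 𝒯.edges with e ⊆ ModelWithCorners.boundary (I := modelI) M,
      𝒯.edgeSum (fun i k =>
        (∫ s in (0 : ℝ)..1, v (𝒯.param i (sidePt k s)) * derivWithin (μ i k) (Set.Icc 0 1) s)
          - curvIntegral g v i k) e)
    - ∑ p ∈ 𝒯.vertices with p ∈ ModelWithCorners.boundary (I := modelI) M,
        v p * (Real.pi - 𝒯.angleJump μ p - angleSum g p)

/-- `∫_e (𝕊σ)(n,n) dv(n) ds` over the `k`-th edge of triangle `i`, with `n` the outward unit normal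
of that triangle. -/
def normalIntegral (g : 𝒯.ReggeMetric) (σ : PiecewiseForm M ι) (v : M → ℝ) (i : ι) (k : Fin 3) :
    ℝ :=
  ∫ s in (0 : ℝ)..1,
    form (opS (g.mat i (sidePt k s)) (𝒯.matrixOf σ i (sidePt k s)))
        (unitNormal (g.mat i (sidePt k s)) k) (unitNormal (g.mat i (sidePt k s)) k) *
      fderivWithin ℝ (v ∘ 𝒯.param i) refTriangle (sidePt k s)
        (unitNormal (g.mat i (sidePt k s)) k) *
      sideSpeed (g.mat i (sidePt k s)) k

/-- The form `b_h(g; σ, v)`. In the edge terms `(𝕊σ)(n,n) = -σ(τ,τ)` takes the same value from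
both sides of an edge, for `σ` with continuous tangential-tangential components, so
`(𝕊σ)(n,n) dv([[n]])` is the sum over the triangles at the edge of `(𝕊σ)(n,n) dv(n)` with `n` the
outward normal of the triangle. -/
def bForm (g : 𝒯.ReggeMetric) (σ : PiecewiseForm M ι) (v : M → ℝ) : ℝ :=
  (∑ i, ∫ x in refTriangle,
      tensorInner (g.mat i x) (opS (g.mat i x) (𝒯.matrixOf σ i x))
          (hessian (g.mat i) (v ∘ 𝒯.param i) x) * areaDensity (g.mat i) x)
    - ∑ e ∈ 𝒯.edges, 𝒯.edgeSum (normalIntegral g σ v) e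

end Triangulation

end Regge

end

/-!
Gathering the edge and vertex terms triangle by triangle, `connDist - curvDist` is a part that does
not depend on the metric minus the sum over the triangles of
`∫ v K dA + ∫_{∂T} v k ds - ∑ v θ`, so it suffices to differentiate the latter on the reference
triangle.

There a constant vector field `d` is the first direction of an orthonormal frame with connection
form `ω`, and `K dA = dω`; when `d` is the direction of a side, `k ds` is the restriction of `ω` to
that side. The variation of `ω` is the sum of a one-form that does not depend on `d`, built from
the curl of the covariant derivative of the velocity of the metric, and of the differential of the
rotation rate `ρ` of `d` relative to a frame transported along the family. The first part, after
two integrations by parts, yields the integral of `⟨𝕊σ, ∇∇v⟩` and the normal part of the edge terms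
of `b_h`. Integrating `dρ` along the sides yields the tangential part together with boundary terms
at the corners, and since the variation of an interior angle is the difference of the rotation
rates of its two sides, these cancel against the variation of `∑ v θ`.
-/

open scoped Manifold ContDiff Matrix

noncomputable section

namespace Regge

open Set MeasureTheory

section DirectionalDerivative

variable {E F : Type*} [NormedAddCommGroup E] [NormedSpace ℝ E] [NormedAddCommGroup F]
  [NormedSpace ℝ F] {S : Set E} {T : Set F} {f g : E → ℝ} {x X Y : E}

/-- The derivative of `f` within `S` in the direction `X`. The set `S` comes before the direction
and the function, so that `dirDeriv S X` is a differential operator. -/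
def dirDeriv (S : Set E) (X : E) (f : E → ℝ) (x : E) : ℝ := fderivWithin ℝ f S x X

theorem dirDeriv_congr (h : EqOn f g S) (hx : x ∈ S) : dirDeriv S X f x = dirDeriv S X g x := by
  rw [dirDeriv, dirDeriv, fderivWithin_congr h (h hx)]

section rules

variable (hS : UniqueDiffWithinAt ℝ S x)
include hS

theorem dirDeriv_add (hf : DifferentiableWithinAt ℝ f S x) (hg : DifferentiableWithinAt ℝ g S x) :
    dirDeriv S X (fun y => f y + g y) x = dirDeriv S X f x + dirDeriv S X g x := by
  simp only [dirDeriv, fderivWithin_fun_add hS hf hg, add_apply]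

theorem dirDeriv_sub (hf : DifferentiableWithinAt ℝ f S x) (hg : DifferentiableWithinAt ℝ g S x) :
    dirDeriv S X (fun y => f y - g y) x = dirDeriv S X f x - dirDeriv S X g x := by
  simp only [dirDeriv, fderivWithin_fun_sub hS hf hg, sub_apply]

theorem dirDeriv_mul (hf : DifferentiableWithinAt ℝ f S x) (hg : DifferentiableWithinAt ℝ g S x) :
    dirDeriv S X (fun y => f y * g y) x = f x * dirDeriv S X g x + g x * dirDeriv S X f x := by
  simp only [dirDeriv, fderivWithin_fun_mul hS hf hg, add_apply,
    smul_apply, smul_eq_mul]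

theorem dirDeriv_const_mul (c : ℝ) (hf : DifferentiableWithinAt ℝ f S x) :
    dirDeriv S X (fun y => c * f y) x = c * dirDeriv S X f x := by
  simp only [dirDeriv, fderivWithin_const_mul hS hf, smul_apply, smul_eq_mul]

theorem dirDeriv_mul_const (c : ℝ) (hf : DifferentiableWithinAt ℝ f S x) :
    dirDeriv S X (fun y => f y * c) x = dirDeriv S X f x * c := by
  simp only [mul_comm _ c, dirDeriv_const_mul hS c hf]

theorem dirDeriv_sum {ι : Type*} {u : Finset ι} {f : ι → E → ℝ}
    (hf : ∀ i ∈ u, DifferentiableWithinAt ℝ (f i) S x) :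
    dirDeriv S X (fun y => ∑ i ∈ u, f i y) x = ∑ i ∈ u, dirDeriv S X (f i) x := by
  simp only [dirDeriv, fderivWithin_fun_sum hS hf, sum_apply]

theorem dirDeriv_div (hf : DifferentiableWithinAt ℝ f S x) (hg : DifferentiableWithinAt ℝ g S x)
    (hgx : g x ≠ 0) :
    dirDeriv S X (fun y => f y / g y) x
      = (g x * dirDeriv S X f x - f x * dirDeriv S X g x) / g x ^ 2 := by
  have h := hf.hasFDerivWithinAt.mul
    ((hasDerivAt_inv hgx).comp_hasFDerivWithinAt x hg.hasFDerivWithinAt)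
  have h' : dirDeriv S X (fun y => f y / g y) x = _ :=
    congrArg (fun L => L X) (h.fderivWithin hS)
  rw [h']
  simp only [dirDeriv, Function.comp_apply, add_apply,
    smul_apply, smul_eq_mul]
  field_simp
  ring

theorem dirDeriv_sqrt (hf : DifferentiableWithinAt ℝ f S x) (hfx : f x ≠ 0) :
    dirDeriv S X (fun y => √(f y)) x = dirDeriv S X f x / (2 * √(f x)) := by
  rw [dirDeriv, fderivWithin_sqrt hf hfx hS, smul_apply, dirDeriv, smul_eq_mul]
  ring

theorem dirDeriv_comp {φ : E → F} {φ' : E →L[ℝ] F} {f : F → ℝ}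
    (hf : DifferentiableWithinAt ℝ f T (φ x)) (hφ : HasFDerivWithinAt φ φ' S x)
    (hmaps : MapsTo φ S T) :
    dirDeriv S X (fun y => f (φ y)) x = dirDeriv T (φ' X) f (φ x) := by
  have h := (hf.hasFDerivWithinAt.comp x hφ hmaps).fderivWithin hS
  exact congrArg (fun L => L X) h

end rules

theorem contDiffOn_dirDeriv {m n : WithTop ℕ∞} (hS : UniqueDiffOn ℝ S) (hf : ContDiffOn ℝ n f S)
    (hmn : m + 1 ≤ n) : ContDiffOn ℝ m (dirDeriv S X f) S :=
  (hf.fderivWithin hS hmn).clm_apply contDiffOn_const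

theorem dirDeriv_comm (hS : UniqueDiffOn ℝ S) (hf : ContDiffOn ℝ 2 f S) (hx : x ∈ S)
    (hx' : x ∈ closure (interior S)) :
    dirDeriv S X (dirDeriv S Y f) x = dirDeriv S Y (dirDeriv S X f) x := by
  have hf' : DifferentiableWithinAt ℝ (fderivWithin ℝ f S) S x :=
    (hf.fderivWithin (m := 1) hS (by norm_num)).differentiableOn one_ne_zero x hx
  have second : ∀ X Y,
      dirDeriv S X (dirDeriv S Y f) x = fderivWithin ℝ (fderivWithin ℝ f S) S x X Y := by
    intro X Y
    have h := (hf'.hasFDerivWithinAt.clm_apply (hasFDerivWithinAt_const Y x S)).fderivWithin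
      (hS x hx)
    rw [dirDeriv, show dirDeriv S Y f = fun y => fderivWithin ℝ f S y Y from rfl, h]
    simp
  have hsymm : IsSymmSndFDerivWithinAt ℝ f S x :=
    (hf x hx).isSymmSndFDerivWithinAt (by simp) hS hx' hx
  rw [second, second, hsymm.eq]

theorem hasDerivWithinAt_comp_dirDeriv {c : ℝ → E} {I : Set ℝ} {s : ℝ}
    (hf : DifferentiableWithinAt ℝ f S (c s)) (hc : HasDerivWithinAt c X I s)
    (hmaps : MapsTo c I S) :
    HasDerivWithinAt (fun r => f (c r)) (dirDeriv S X f (c s)) I s :=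
  hf.hasFDerivWithinAt.comp_hasDerivWithinAt s hc hmaps

theorem integral_dirDeriv_segment (hS : UniqueDiffOn ℝ S) (hf : ContDiffOn ℝ 1 f S)
    {c : ℝ → E} (hc : ∀ s, HasDerivAt c X s) {l : ℝ} (hl : 0 ≤ l) (hmaps : MapsTo c (Icc 0 l) S) :
    ∫ s in (0 : ℝ)..l, dirDeriv S X f (c s) = f (c l) - f (c 0) := by
  have hcont : ContinuousOn c (Icc 0 l) := fun s _ => (hc s).continuousAt.continuousWithinAt
  refine intervalIntegral.integral_eq_sub_of_hasDerivAt_of_le hl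
    (hf.continuousOn.comp hcont hmaps) (fun s hs => ?_) (ContinuousOn.intervalIntegrable_of_Icc hl
      ((contDiffOn_dirDeriv hS hf (m := 0) (by simp)).continuousOn.comp hcont hmaps))
  exact (hasDerivWithinAt_comp_dirDeriv
    (hf.differentiableOn one_ne_zero _ (hmaps (Ioo_subset_Icc_self hs)))
    (hc s).hasDerivWithinAt hmaps).hasDerivAt (Icc_mem_nhds hs.1 hs.2)

end DirectionalDerivative

theorem convex_refTriangle : Convex ℝ refTriangle := by
  rintro x ⟨hx0, hx1, hx⟩ y ⟨hy0, hy1, hy⟩ a b ha hb hab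
  refine ⟨?_, ?_, ?_⟩ <;> simp only [Pi.add_apply, Pi.smul_apply, smul_eq_mul]
  · positivity
  · positivity
  · nlinarith

theorem isClosed_refTriangle : IsClosed refTriangle := by
  refine (isClosed_le (f := fun _ : Coord => (0 : ℝ)) (g := fun x => x 0) ?_ ?_).inter
    ((isClosed_le (f := fun _ : Coord => (0 : ℝ)) (g := fun x => x 1) ?_ ?_).inter
      (isClosed_le (f := fun x : Coord => x 0 + x 1) (g := fun _ => (1 : ℝ)) ?_ ?_)) <;> fun_prop

theorem isCompact_refTriangle : IsCompact refTriangle := by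
  refine (isCompact_Icc (a := (0 : Coord)) (b := 1)).of_isClosed_subset isClosed_refTriangle ?_
  rintro x ⟨hx0, hx1, hx⟩
  refine ⟨fun i => ?_, fun i => ?_⟩ <;> fin_cases i <;> simp <;> linarith

theorem interior_refTriangle_nonempty : (interior refTriangle).Nonempty := by
  let U : Set Coord := {x | 0 < x 0} ∩ ({x | 0 < x 1} ∩ {x | x 0 + x 1 < 1})
  have hU : IsOpen U := by
    refine (isOpen_lt ?_ ?_).inter ((isOpen_lt ?_ ?_).inter (isOpen_lt ?_ ?_)) <;> fun_prop
  refine ⟨![1 / 4, 1 / 4], mem_interior.2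
    ⟨U, fun x hx => ⟨hx.1.le, hx.2.1.le, hx.2.2.le⟩, hU, ?_⟩⟩
  norm_num [U]

theorem uniqueDiffOn_refTriangle : UniqueDiffOn ℝ refTriangle :=
  uniqueDiffOn_convex convex_refTriangle interior_refTriangle_nonempty

theorem continuousOn_partialD {f : Coord → ℝ} (hf : ContDiffOn ℝ 1 f refTriangle) (a : Fin 2) :
    ContinuousOn (partialD a f) refTriangle :=
  (contDiffOn_dirDeriv uniqueDiffOn_refTriangle hf (m := 0) (by simp)).continuousOn

theorem refVertex_mem (k : Fin 3) : refVertex k ∈ refTriangle := by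
  fin_cases k <;> simp [refVertex, refTriangle]

theorem sidePt_zero (k : Fin 3) : sidePt k 0 = refVertex k := by simp [sidePt]

theorem sidePt_one (k : Fin 3) : sidePt k 1 = refVertex (k + 1) := by simp [sidePt, sideDir]

theorem mapsTo_sidePt (k : Fin 3) : MapsTo (sidePt k) (Icc 0 1) refTriangle := by
  intro s hs
  have hcomb : sidePt k s = (1 - s) • refVertex k + s • refVertex (k + 1) := by
    simp only [sidePt, sideDir]
    module
  rw [hcomb]
  exact convex_refTriangle (refVertex_mem k) (refVertex_mem (k + 1)) (by linarith [hs.2]) hs.1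
    (by ring)

theorem hasDerivAt_sidePt (k : Fin 3) (s : ℝ) : HasDerivAt (sidePt k) (sideDir k) s := by
  have h := ((hasDerivAt_id s).smul_const (sideDir k)).const_add (refVertex k)
  rwa [one_smul] at h

theorem continuous_sidePt (k : Fin 3) : Continuous (sidePt k) :=
  continuous_iff_continuousAt.2 fun s => (hasDerivAt_sidePt k s).continuousAt

theorem sideDir_eq : sideDir = ![![1, 0], ![-1, 1], ![0, -1]] := by
  ext k i; fin_cases k <;> fin_cases i <;> simp [sideDir, refVertex]

theorem sideConormal_eq : sideConormal = ![![0, -1], ![1, 1], ![-1, 0]] := by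
  ext k i; fin_cases k <;> fin_cases i <;> simp [sideConormal, sideDir_eq]

theorem sideDir_ne_zero (k : Fin 3) : sideDir k ≠ 0 := by
  intro h
  have h0 := congrFun h 0
  have h1 := congrFun h 1
  fin_cases k <;> simp [sideDir_eq] at h0 h1

theorem dirDeriv_eq_sum_partialD (X : Coord) (f : Coord → ℝ) (x : Coord) :
    dirDeriv refTriangle X f x = ∑ a, X a * partialD a f x := by
  conv_lhs => rw [dirDeriv, pi_eq_sum_univ' X, map_sum]
  simp only [map_smul, smul_eq_mul]
  rfl

/-- The point with `a`-th coordinate `s` and other coordinate `r`. -/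
def axisPt (a : Fin 2) (s r : ℝ) : Coord := s • Pi.single a 1 + r • Pi.single (a + 1) 1

theorem axisPt_mem_refTriangle {a : Fin 2} {s r : ℝ} :
    axisPt a s r ∈ refTriangle ↔ r ∈ Icc (0 : ℝ) 1 ∧ s ∈ Icc 0 (1 - r) := by
  have : axisPt a s r ∈ refTriangle ↔ 0 ≤ s ∧ 0 ≤ r ∧ s + r ≤ 1 := by
    fin_cases a
    · simp [axisPt, refTriangle]
    · simp [axisPt, refTriangle, add_comm r s, and_left_comm]
  rw [this, mem_Icc, mem_Icc]
  constructor
  · rintro ⟨hs, hr, hsr⟩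
    exact ⟨⟨hr, by linarith⟩, hs, by linarith⟩
  · rintro ⟨⟨hr, -⟩, hs, hsr⟩
    exact ⟨hs, hr, by linarith⟩

theorem hasDerivAt_axisPt (a : Fin 2) (s r : ℝ) :
    HasDerivAt (fun s => axisPt a s r) (Pi.single a 1) s := by
  have h := ((hasDerivAt_id s).smul_const (Pi.single a 1 : Coord)).add_const
    (r • Pi.single (a + 1) 1)
  rwa [one_smul] at h

theorem exists_measurePreserving_axisPt (a : Fin 2) :
    ∃ e : ℝ × ℝ ≃ᵐ Coord, MeasurePreserving e ∧ ∀ p, e p = axisPt a p.1 p.2 := by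
  fin_cases a
  · refine ⟨MeasurableEquiv.finTwoArrow.symm, (volume_preserving_finTwoArrow ℝ).symm _, fun p => ?_⟩
    ext i; fin_cases i <;> simp [axisPt]
  · refine ⟨MeasurableEquiv.prodComm.trans MeasurableEquiv.finTwoArrow.symm,
      ((volume_preserving_finTwoArrow ℝ).symm _).comp Measure.measurePreserving_swap, fun p => ?_⟩
    ext i; fin_cases i <;> simp [axisPt, MeasurableEquiv.prodComm]

theorem integral_refTriangle_eq_iterated {f : Coord → ℝ} (hf : ContinuousOn f refTriangle)
    (a : Fin 2) :
    ∫ x in refTriangle, f x = ∫ r in (0 : ℝ)..1, ∫ s in (0 : ℝ)..(1 - r), f (axisPt a s r) := by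
  obtain ⟨e, he, heq⟩ := exists_measurePreserving_axisPt a
  have hmeas := isClosed_refTriangle.measurableSet
  have hint : Integrable fun p : ℝ × ℝ => refTriangle.indicator f (axisPt a p.1 p.2) := by
    simp only [← heq]
    exact he.integrable_comp_of_integrable
      ((integrable_indicator_iff hmeas).2 (hf.integrableOn_compact isCompact_refTriangle))
  have slice : ∀ r, ∫ s, refTriangle.indicator f (axisPt a s r)
      = (Icc (0 : ℝ) 1).indicator (fun r => ∫ s in (0 : ℝ)..(1 - r), f (axisPt a s r)) r := by
    intro r
    by_cases hr : r ∈ Icc (0 : ℝ) 1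
    · rw [indicator_of_mem hr, intervalIntegral.integral_of_le (by linarith [hr.2]),
        ← integral_Icc_eq_integral_Ioc, ← integral_indicator measurableSet_Icc]
      exact integral_congr_ae (.of_forall fun s => indicator_eq_indicator
        (axisPt_mem_refTriangle.trans (and_iff_right hr)) rfl)
    · have hout : ∀ s, axisPt a s r ∉ refTriangle := fun s hs => hr (axisPt_mem_refTriangle.1 hs).1
      simp [hr, hout]
  rw [← integral_indicator hmeas, ← he.integral_comp']
  simp only [heq]
  rw [Measure.volume_eq_prod, integral_prod_symm _ hint]
  simp only [slice]
  rw [integral_indicator measurableSet_Icc, integral_Icc_eq_integral_Ioc,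
    intervalIntegral.integral_of_le zero_le_one]

theorem integral_partialD {f : Coord → ℝ} (hf : ContDiffOn ℝ 1 f refTriangle) (a : Fin 2) :
    ∫ x in refTriangle, partialD a f x
      = ∫ r in (0 : ℝ)..1, (f (axisPt a (1 - r) r) - f (axisPt a 0 r)) := by
  rw [integral_refTriangle_eq_iterated (continuousOn_partialD hf a) a]
  refine intervalIntegral.integral_congr fun r hr => ?_
  rw [uIcc_of_le zero_le_one] at hr
  exact integral_dirDeriv_segment uniqueDiffOn_refTriangle hf (hasDerivAt_axisPt a · r)
    (by linarith [hr.2]) fun s hs => axisPt_mem_refTriangle.2 ⟨hr, hs⟩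

theorem integral_partialD_eq_sum_sides {f : Coord → ℝ} (hf : ContDiffOn ℝ 1 f refTriangle)
    (a : Fin 2) :
    ∫ x in refTriangle, partialD a f x
      = ∑ k, ∫ s in (0 : ℝ)..1, f (sidePt k s) * sideConormal k a := by
  have hint : ∀ k, IntervalIntegrable (fun s => f (sidePt k s)) volume 0 1 := fun k =>
    (hf.continuousOn.comp (continuous_sidePt k).continuousOn
      (mapsTo_sidePt k)).intervalIntegrable_of_Icc zero_le_one
  have reverse : ∀ k, ∫ s in (0 : ℝ)..1, f (sidePt k (1 - s)) = ∫ s in (0 : ℝ)..1, f (sidePt k s) :=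
    fun k => by
      rw [intervalIntegral.integral_comp_sub_left (fun s => f (sidePt k s)) 1, sub_self, sub_zero]
  have hint_reverse : ∀ k, IntervalIntegrable (fun s => f (sidePt k (1 - s))) volume 0 1 :=
    fun k => by simpa using ((hint k).comp_sub_left 1).symm
  have hside : ∀ r, axisPt 0 (1 - r) r = sidePt 1 r ∧ axisPt 0 0 r = sidePt 2 (1 - r) ∧
      axisPt 1 (1 - r) r = sidePt 1 (1 - r) ∧ axisPt 1 0 r = sidePt 0 r := by
    intro r
    refine ⟨?_, ?_, ?_, ?_⟩ <;> ext i <;> fin_cases i <;>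
      (simp [axisPt, sidePt, sideDir_eq, refVertex]; try ring)
  rw [integral_partialD hf, Fin.sum_univ_three]
  fin_cases a
  · simp only [Fin.zero_eta, hside]
    rw [intervalIntegral.integral_sub (hint 1) (hint_reverse 2), reverse]
    simp [sideConormal_eq, sub_eq_add_neg]
  · simp only [Fin.mk_one, hside]
    rw [intervalIntegral.integral_sub (hint_reverse 1) (hint 0), reverse]
    simp [sideConormal_eq, sub_eq_neg_add]

theorem integral_divergence_refTriangle {f : Fin 2 → Coord → ℝ}
    (hf : ∀ a, ContDiffOn ℝ 1 (f a) refTriangle) :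
    ∫ x in refTriangle, ∑ a, partialD a (f a) x
      = ∑ k, ∫ s in (0 : ℝ)..1, ∑ a, f a (sidePt k s) * sideConormal k a := by
  rw [integral_finsetSum _ fun a _ =>
    (continuousOn_partialD (hf a) a).integrableOn_compact isCompact_refTriangle]
  simp only [integral_partialD_eq_sum_sides (hf _)]
  rw [Finset.sum_comm]
  refine Finset.sum_congr rfl fun k _ => (intervalIntegral.integral_finsetSum fun a _ => ?_).symm
  exact (((hf a).continuousOn.comp (continuous_sidePt k).continuousOn
    (mapsTo_sidePt k)).intervalIntegrable_of_Icc zero_le_one).mul_const _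

theorem hasDerivWithinAt_setIntegral {X E : Type*} [TopologicalSpace X] [T2Space X]
    [MeasurableSpace X] [BorelSpace X] [NormedAddCommGroup E] [NormedSpace ℝ E]
    {ν : Measure X} [IsFiniteMeasureOnCompacts ν] {I : Set ℝ} (hI : IsCompact I)
    (hIconv : Convex ℝ I) {K : Set X} (hK : IsCompact K) {f f' : ℝ → X → E}
    (hf : ∀ s ∈ I, ContinuousOn (f s) K)
    (hf' : ContinuousOn (fun q : ℝ × X => f' q.1 q.2) (I ×ˢ K))
    (hd : ∀ s ∈ I, ∀ x ∈ K, HasDerivWithinAt (fun s => f s x) (f' s x) I s) {t : ℝ} (ht : t ∈ I) :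
    HasDerivWithinAt (fun s => ∫ x in K, f s x ∂ν) (∫ x in K, f' t x ∂ν) I t := by
  obtain ⟨C, hC⟩ := (hI.prod hK).exists_bound_of_continuousOn hf'
  have hint : ∀ s ∈ I, IntegrableOn (f s) K ν := fun s hs => (hf s hs).integrableOn_compact' hK
    hK.measurableSet
  have near : ∀ᶠ s in nhdsWithin t (I \ {t}), s ∈ I \ {t} := self_mem_nhdsWithin
  have slopes : Filter.Tendsto (fun s => ∫ x in K, slope (fun s => f s x) t s ∂ν)
      (nhdsWithin t (I \ {t})) (nhds (∫ x in K, f' t x ∂ν)) := by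
    refine tendsto_integral_filter_of_dominated_convergence (fun _ => C) ?_ ?_
      (integrableOn_const hK.measure_lt_top.ne) ?_
    · filter_upwards [near] with s hs
      simp only [slope_def_module]
      exact (((hint s hs.1).sub (hint t ht)).smul _).aestronglyMeasurable
    · filter_upwards [near] with s hs
      filter_upwards [ae_restrict_mem hK.measurableSet] with x hx
      have hne : 0 < ‖s - t‖ := norm_pos_iff.2 (sub_ne_zero.2 hs.2)
      rw [slope_def_module, norm_smul, norm_inv, inv_mul_le_iff₀ hne, mul_comm]
      exact hIconv.norm_image_sub_le_of_norm_hasDerivWithin_le (fun r hr => hd r hr x hx)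
        (fun r hr => hC (r, x) ⟨hr, hx⟩) ht hs.1
    · filter_upwards [ae_restrict_mem hK.measurableSet] with x hx
      exact hasDerivWithinAt_iff_tendsto_slope.1 (hd t ht x hx)
  rw [hasDerivWithinAt_iff_tendsto_slope]
  refine slopes.congr' ?_
  filter_upwards [near] with s hs
  simp only [slope_def_module]
  rw [integral_smul, integral_sub (hint s hs.1) (hint t ht)]

/-- The product of the parameter interval and the reference triangle: the domain of the
coefficients of a one-parameter family. -/
def prism : Set (ℝ × Coord) := Icc 0 1 ×ˢ refTriangle

/-- The direction of the parameter, called time. -/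
def timeDir : ℝ × Coord := (1, 0)

/-- The coordinate directions of the triangle, as directions in the prism. -/
def spaceDir (a : Fin 2) : ℝ × Coord := (0, Pi.single a 1)

local notation "∂ₜ" => dirDeriv prism timeDir
local notation "∂ₓ[" a "]" => dirDeriv prism (spaceDir a)

theorem convex_prism : Convex ℝ prism := (convex_Icc 0 1).prod convex_refTriangle

theorem interior_prism_nonempty : (interior prism).Nonempty := by
  rw [prism, interior_prod_eq, interior_Icc]
  exact (nonempty_Ioo.2 one_pos).prod interior_refTriangle_nonempty

theorem uniqueDiffOn_prism : UniqueDiffOn ℝ prism :=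
  uniqueDiffOn_convex convex_prism interior_prism_nonempty

theorem prism_subset_closure_interior : prism ⊆ closure (interior prism) := by
  rw [convex_prism.closure_interior_eq_closure_of_nonempty_interior interior_prism_nonempty]
  exact subset_closure

section Prism

variable {f : ℝ × Coord → ℝ} {q : ℝ × Coord} {t : ℝ}

theorem differentiableWithinAt_prism (hf : ContDiffOn ℝ ∞ f prism) (hq : q ∈ prism) :
    DifferentiableWithinAt ℝ f prism q :=
  hf.differentiableOn (by simp) q hq

theorem contDiffOn_slice {n : WithTop ℕ∞} (hf : ContDiffOn ℝ n f prism) (ht : t ∈ Icc (0 : ℝ) 1) :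
    ContDiffOn ℝ n (fun x => f (t, x)) refTriangle :=
  hf.comp (contDiff_prodMk_right t).contDiffOn fun _ hx => ⟨ht, hx⟩

theorem partialD_slice (hf : DifferentiableWithinAt ℝ f prism q) (hq : q ∈ prism) (a : Fin 2) :
    partialD a (fun x => f (q.1, x)) q.2 = ∂ₓ[a] f q :=
  dirDeriv_comp (uniqueDiffOn_refTriangle q.2 hq.2) hf
    (hasFDerivAt_prodMk_right q.1 q.2).hasFDerivWithinAt fun _ hx => ⟨hq.1, hx⟩

theorem hasDerivWithinAt_time (hf : DifferentiableWithinAt ℝ f prism q) (hq : q ∈ prism) :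
    HasDerivWithinAt (fun s => f (s, q.2)) (∂ₜ f q) (Icc 0 1) q.1 :=
  hasDerivWithinAt_comp_dirDeriv hf
    ((hasDerivAt_id' q.1).prodMk (hasDerivAt_const q.1 q.2)).hasDerivWithinAt
    fun _ hs => ⟨hs, hq.2⟩

variable (hf : ContDiffOn ℝ 1 f prism)
include hf

theorem continuousOn_timeDeriv : ContinuousOn (∂ₜ f) prism :=
  (contDiffOn_dirDeriv uniqueDiffOn_prism hf (m := 0) (by simp)).continuousOn

theorem hasDerivWithinAt_integral_refTriangle {w : Coord → ℝ} (hw : ContinuousOn w refTriangle)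
    (ht : t ∈ Icc (0 : ℝ) 1) :
    HasDerivWithinAt (fun s => ∫ x in refTriangle, w x * f (s, x))
      (∫ x in refTriangle, w x * ∂ₜ f (t, x)) (Icc 0 1) t := by
  refine hasDerivWithinAt_setIntegral (f := fun s x => w x * f (s, x))
    (f' := fun s x => w x * ∂ₜ f (s, x)) isCompact_Icc (convex_Icc 0 1)
    isCompact_refTriangle (fun s hs => hw.mul (contDiffOn_slice hf hs).continuousOn)
    ((hw.comp continuousOn_snd fun q hq => hq.2).mul (continuousOn_timeDeriv hf))
    (fun s hs x hx => ?_) ht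
  exact (hasDerivWithinAt_time (hf.differentiableOn one_ne_zero (s, x) ⟨hs, hx⟩)
    ⟨hs, hx⟩).const_mul (w x)

theorem hasDerivWithinAt_integral_side {w : Coord → ℝ} (hw : ContinuousOn w refTriangle)
    (k : Fin 3) (ht : t ∈ Icc (0 : ℝ) 1) :
    HasDerivWithinAt (fun r => ∫ s in (0 : ℝ)..1, w (sidePt k s) * f (r, sidePt k s))
      (∫ s in (0 : ℝ)..1, w (sidePt k s) * ∂ₜ f (t, sidePt k s))
      (Icc 0 1) t := by
  simp only [intervalIntegral.integral_of_le zero_le_one, ← integral_Icc_eq_integral_Ioc]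
  have hmaps := mapsTo_sidePt k
  have hside := (continuous_sidePt k).continuousOn (s := Icc 0 1)
  have hpair : ContinuousOn (fun q : ℝ × ℝ => (q.1, sidePt k q.2)) (Icc 0 1 ×ˢ Icc 0 1) :=
    (continuous_fst.prodMk ((continuous_sidePt k).comp continuous_snd)).continuousOn
  refine hasDerivWithinAt_setIntegral (f := fun r s => w (sidePt k s) * f (r, sidePt k s))
    (f' := fun r s => w (sidePt k s) * ∂ₜ f (r, sidePt k s)) isCompact_Icc
    (convex_Icc 0 1) isCompact_Icc (fun r hr => ?_) ?_ (fun r hr s hs => ?_) ht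
  · exact (hw.comp hside hmaps).mul ((contDiffOn_slice hf hr).continuousOn.comp hside hmaps)
  · exact ((hw.comp hside hmaps).comp continuousOn_snd fun q hq => hq.2).mul
      ((continuousOn_timeDeriv hf).comp hpair fun q hq => ⟨hq.1, hmaps hq.2⟩)
  · exact (hasDerivWithinAt_time (hf.differentiableOn one_ne_zero (r, sidePt k s) ⟨hr, hmaps hs⟩)
      ⟨hr, hmaps hs⟩).const_mul _

end Prism

/-- A family of Riemannian metrics on the reference triangle, smooth in time and space. -/
structure MetricFamily (G : ℝ → MatField) : Prop where
  smooth : ∀ a b, ContDiffOn ℝ ∞ (fun q : ℝ × Coord => G q.1 q.2 a b) prism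
  posDef : ∀ q ∈ prism, (G q.1 q.2).PosDef

/-- The determinant of two vectors. -/
def cross (u w : Coord) : ℝ := u 0 * w 1 - u 1 * w 0

section Definitions

variable (G : ℝ → MatField)

/-- The metric coefficient `g_{ab}` as a function of time and space. -/
def coef (a b : Fin 2) (q : ℝ × Coord) : ℝ := G q.1 q.2 a b

/-- The Christoffel symbol `Γ^c_{ab}` as a function of time and space. -/
def gam (c a b : Fin 2) (q : ℝ × Coord) : ℝ := christoffel (G q.1) c a b q.2

/-- The area density `√det g` as a function of time and space. -/
def area (q : ℝ × Coord) : ℝ := areaDensity (G q.1) q.2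

/-- The squared length `g(d, d)` of the constant vector field `d`. -/
def lenSq (d : Coord) (q : ℝ × Coord) : ℝ := form (G q.1 q.2) d d

/-- The covariant derivative `∇_a d` of the constant vector field `d`. -/
def covVec (d : Coord) (a : Fin 2) (q : ℝ × Coord) : Coord := fun c => ∑ b, gam G c a b q * d b

/-- The connection form `ω_a = dA(d, ∇_a d) / g(d, d)` of the orthonormal frame that starts with
the direction of the constant vector field `d`. -/
def conn (d : Coord) (a : Fin 2) (q : ℝ × Coord) : ℝ :=
  area G q * cross d (covVec G d a q) / lenSq G d q

end Definitions

namespace MetricFamily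

variable {G : ℝ → MatField} (hG : MetricFamily G) {q : ℝ × Coord}
include hG

theorem contDiffOn_coef (a b : Fin 2) : ContDiffOn ℝ ∞ (coef G a b) prism := hG.smooth a b

theorem det_pos (hq : q ∈ prism) : 0 < (G q.1 q.2).det := (hG.posDef q hq).det_pos

theorem coef_comm (a b : Fin 2) : EqOn (coef G a b) (coef G b a) prism := fun q hq =>
  (hG.posDef q hq).1.apply b a

theorem dirDeriv_coef_comm (X : ℝ × Coord) (a b : Fin 2) (hq : q ∈ prism) :
    dirDeriv prism X (coef G a b) q = dirDeriv prism X (coef G b a) q :=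
  dirDeriv_congr (hG.coef_comm a b) hq

theorem area_pos (hq : q ∈ prism) : 0 < area G q := Real.sqrt_pos.2 (hG.det_pos hq)

theorem area_sq (hq : q ∈ prism) :
    area G q ^ 2 = coef G 0 0 q * coef G 1 1 q - coef G 0 1 q ^ 2 := by
  rw [area, areaDensity, Real.sq_sqrt (hG.det_pos hq).le, Matrix.det_fin_two, sq]
  exact congrArg _ (congrArg _ (hG.coef_comm 1 0 hq))

theorem lenSq_pos {d : Coord} (hd : d ≠ 0) (hq : q ∈ prism) : 0 < lenSq G d q := by
  simpa [lenSq, form] using (hG.posDef q hq).dotProduct_mulVec_pos hd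

theorem lenSq_eq (d : Coord) (hq : q ∈ prism) :
    lenSq G d q = coef G 0 0 q * d 0 ^ 2 + 2 * coef G 0 1 q * (d 0 * d 1)
      + coef G 1 1 q * d 1 ^ 2 := by
  have hsymm : G q.1 q.2 1 0 = G q.1 q.2 0 1 := hG.coef_comm 1 0 hq
  simp only [lenSq, form, coef, dotProduct, Matrix.mulVec, Fin.sum_univ_two, hsymm]
  ring

theorem contDiffOn_det : ContDiffOn ℝ ∞ (fun q : ℝ × Coord => (G q.1 q.2).det) prism := by
  simp only [Matrix.det_fin_two]
  exact ((hG.smooth 0 0).mul (hG.smooth 1 1)).sub ((hG.smooth 0 1).mul (hG.smooth 1 0))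

theorem contDiffOn_inv (a b : Fin 2) :
    ContDiffOn ℝ ∞ (fun q : ℝ × Coord => (G q.1 q.2)⁻¹ a b) prism := by
  have hadj : ContDiffOn ℝ ∞ (fun q : ℝ × Coord => (G q.1 q.2).adjugate a b) prism := by
    simp only [Matrix.adjugate_fin_two]
    fin_cases a <;> fin_cases b
    exacts [hG.smooth 1 1, (hG.smooth 0 1).neg, (hG.smooth 1 0).neg, hG.smooth 0 0]
  refine (hadj.div hG.contDiffOn_det fun q hq => (hG.det_pos hq).ne').congr fun q _ => ?_
  rw [Matrix.inv_def, Matrix.smul_apply, Ring.inverse_eq_inv', smul_eq_mul, inv_mul_eq_div]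
  rfl

theorem contDiffOn_area : ContDiffOn ℝ ∞ (area G) prism :=
  hG.contDiffOn_det.sqrt fun _ hq => (hG.det_pos hq).ne'

theorem contDiffOn_dirDeriv_coef (X : ℝ × Coord) (a b : Fin 2) :
    ContDiffOn ℝ ∞ (dirDeriv prism X (coef G a b)) prism :=
  contDiffOn_dirDeriv uniqueDiffOn_prism (hG.contDiffOn_coef a b) (by simp)

theorem gam_eq (c a b : Fin 2) (hq : q ∈ prism) :
    gam G c a b q = (1 / 2) * ∑ d, (G q.1 q.2)⁻¹ c d *
      (∂ₓ[a] (coef G b d) q + ∂ₓ[b] (coef G a d) q - ∂ₓ[d] (coef G a b) q) := by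
  have hpartial : ∀ a b c, partialD a (fun x => G q.1 x b c) q.2 = ∂ₓ[a] (coef G b c) q :=
    fun a b c => partialD_slice (differentiableWithinAt_prism (hG.contDiffOn_coef b c) hq) hq a
  simp only [gam, christoffel, hpartial]

theorem contDiffOn_gam (c a b : Fin 2) : ContDiffOn ℝ ∞ (gam G c a b) prism := by
  refine ContDiffOn.congr (contDiffOn_const.mul (ContDiffOn.sum fun d _ =>
    (hG.contDiffOn_inv c d).mul
      (((hG.contDiffOn_dirDeriv_coef _ b d).add (hG.contDiffOn_dirDeriv_coef _ a d)).sub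
        (hG.contDiffOn_dirDeriv_coef _ a b)))) fun q hq => hG.gam_eq c a b hq

theorem contDiffOn_lenSq (d : Coord) : ContDiffOn ℝ ∞ (lenSq G d) prism := by
  refine ContDiffOn.congr ?_ fun q hq => hG.lenSq_eq d hq
  have h := hG.contDiffOn_coef
  exact (((h 0 0).mul contDiffOn_const).add
    ((contDiffOn_const.mul (h 0 1)).mul contDiffOn_const)).add ((h 1 1).mul contDiffOn_const)

theorem contDiffOn_covVec (d : Coord) (a c : Fin 2) :
    ContDiffOn ℝ ∞ (fun q => covVec G d a q c) prism :=
  ContDiffOn.sum fun b _ => (hG.contDiffOn_gam c a b).mul contDiffOn_const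

theorem contDiffOn_conn {d : Coord} (hd : d ≠ 0) (a : Fin 2) :
    ContDiffOn ℝ ∞ (conn G d a) prism :=
  (hG.contDiffOn_area.mul ((contDiffOn_const.mul (hG.contDiffOn_covVec d a 1)).sub
    (contDiffOn_const.mul (hG.contDiffOn_covVec d a 0)))).div (hG.contDiffOn_lenSq d)
    fun _ hq => (hG.lenSq_pos hd hq).ne'

theorem gam_comm (c a b : Fin 2) : EqOn (gam G c a b) (gam G c b a) prism := fun q hq => by
  rw [hG.gam_eq c a b hq, hG.gam_eq c b a hq]
  refine congrArg _ (Finset.sum_congr rfl fun d _ => ?_)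
  rw [hG.dirDeriv_coef_comm _ b a hq]
  ring

theorem sum_coef_mul_gam (c a b : Fin 2) (hq : q ∈ prism) :
    ∑ e, coef G c e q * gam G e a b q
      = (∂ₓ[a] (coef G b c) q + ∂ₓ[b] (coef G a c) q - ∂ₓ[c] (coef G a b) q) / 2 := by
  let w : Coord := fun d =>
    (∂ₓ[a] (coef G b d) q + ∂ₓ[b] (coef G a d) q - ∂ₓ[d] (coef G a b) q) / 2
  have hgam : (fun e => gam G e a b q) = (G q.1 q.2)⁻¹ *ᵥ w := by
    ext e
    simp only [hG.gam_eq e a b hq, Matrix.mulVec, dotProduct, Finset.mul_sum, w]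
    exact Finset.sum_congr rfl fun d _ => by ring
  have hw : G q.1 q.2 *ᵥ (fun e => gam G e a b q) = w := by
    rw [hgam, Matrix.mulVec_mulVec, Matrix.mul_nonsing_inv _ (hG.det_pos hq).ne'.isUnit,
      Matrix.one_mulVec]
  exact congrFun hw c

theorem spaceDeriv_coef (a b c : Fin 2) (hq : q ∈ prism) :
    ∂ₓ[a] (coef G b c) q
      = ∑ e, (coef G c e q * gam G e a b q + coef G b e q * gam G e a c q) := by
  rw [Finset.sum_add_distrib, hG.sum_coef_mul_gam c a b hq, hG.sum_coef_mul_gam b a c hq,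
    hG.dirDeriv_coef_comm _ c b hq]
  ring

theorem dirDeriv_lenSq (X : ℝ × Coord) (d : Coord) (hq : q ∈ prism) :
    dirDeriv prism X (lenSq G d) q
      = dirDeriv prism X (coef G 0 0) q * d 0 ^ 2
        + 2 * dirDeriv prism X (coef G 0 1) q * (d 0 * d 1)
        + dirDeriv prism X (coef G 1 1) q * d 1 ^ 2 := by
  have hS := uniqueDiffOn_prism q hq
  have hd : ∀ a b, DifferentiableWithinAt ℝ (coef G a b) prism q := fun a b =>
    differentiableWithinAt_prism (hG.contDiffOn_coef a b) hq
  rw [dirDeriv_congr (fun p hp => hG.lenSq_eq d hp) hq,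
    dirDeriv_add hS (by fun_prop) (by fun_prop), dirDeriv_add hS (by fun_prop) (by fun_prop),
    dirDeriv_mul_const hS _ (hd 0 0), dirDeriv_mul_const hS _ (by fun_prop),
    dirDeriv_const_mul hS _ (hd 0 1), dirDeriv_mul_const hS _ (hd 1 1)]

theorem dirDeriv_area (X : ℝ × Coord) (hq : q ∈ prism) :
    dirDeriv prism X (area G) q
      = (coef G 1 1 q * dirDeriv prism X (coef G 0 0) q
          + coef G 0 0 q * dirDeriv prism X (coef G 1 1) q
          - 2 * coef G 0 1 q * dirDeriv prism X (coef G 0 1) q) / (2 * area G q) := by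
  have hS := uniqueDiffOn_prism q hq
  have hd : ∀ a b, DifferentiableWithinAt ℝ (coef G a b) prism q := fun a b =>
    differentiableWithinAt_prism (hG.contDiffOn_coef a b) hq
  have hdet : dirDeriv prism X (fun p => (G p.1 p.2).det) q = _ :=
    (dirDeriv_congr (fun p _ => Matrix.det_fin_two (G p.1 p.2)) hq).trans
      ((dirDeriv_sub hS ((hd 0 0).mul (hd 1 1)) ((hd 0 1).mul (hd 1 0))).trans
        (congrArg₂ _ (dirDeriv_mul hS (hd 0 0) (hd 1 1)) (dirDeriv_mul hS (hd 0 1) (hd 1 0))))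
  have hsqrt := dirDeriv_sqrt (X := X) hS (differentiableWithinAt_prism hG.contDiffOn_det hq)
    (hG.det_pos hq).ne'
  rw [hdet, hG.dirDeriv_coef_comm X 1 0 hq, hG.coef_comm 1 0 hq] at hsqrt
  refine hsqrt.trans (congrArg₂ _ ?_ rfl)
  ring

theorem spaceDeriv_area (a : Fin 2) (hq : q ∈ prism) :
    ∂ₓ[a] (area G) q = area G q * ∑ e, gam G e a e q := by
  have hr := (hG.area_pos hq).ne'
  rw [hG.dirDeriv_area _ hq, div_eq_iff (by positivity)]
  simp only [hG.spaceDeriv_coef a _ _ hq, Fin.sum_univ_two, hG.coef_comm 1 0 hq]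
  linear_combination (-2 * (gam G 0 a 0 q + gam G 1 a 1 q)) * hG.area_sq hq

theorem spaceDeriv_lenSq (d : Coord) (a : Fin 2) (hq : q ∈ prism) :
    ∂ₓ[a] (lenSq G d) q = 2 * form (G q.1 q.2) d (covVec G d a q) := by
  have hcomm : G q.1 q.2 1 0 = G q.1 q.2 0 1 := hG.coef_comm 1 0 hq
  rw [hG.dirDeriv_lenSq _ d hq]
  simp only [hG.spaceDeriv_coef a _ _ hq, form, covVec, dotProduct, Matrix.mulVec,
    Fin.sum_univ_two, coef, hcomm]
  ring

theorem dirDeriv_covVec (X : ℝ × Coord) (d : Coord) (a c : Fin 2) (hq : q ∈ prism) :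
    dirDeriv prism X (fun p => covVec G d a p c) q
      = ∑ b, dirDeriv prism X (gam G c a b) q * d b := by
  have hS := uniqueDiffOn_prism q hq
  have hd : ∀ b, DifferentiableWithinAt ℝ (gam G c a b) prism q := fun b =>
    differentiableWithinAt_prism (hG.contDiffOn_gam c a b) hq
  exact (dirDeriv_sum hS fun b _ => (hd b).mul_const _).trans
    (Finset.sum_congr rfl fun b _ => dirDeriv_mul_const hS _ (hd b))

theorem dirDeriv_conn (X : ℝ × Coord) {d : Coord} (hd : d ≠ 0) (a : Fin 2) (hq : q ∈ prism) :
    dirDeriv prism X (conn G d a) q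
      = (dirDeriv prism X (area G) q * cross d (covVec G d a q)
          + area G q * cross d (fun c => ∑ b, dirDeriv prism X (gam G c a b) q * d b)
          - conn G d a q * dirDeriv prism X (lenSq G d) q) / lenSq G d q := by
  have hS := uniqueDiffOn_prism q hq
  have hL := (hG.lenSq_pos hd hq).ne'
  have hdr := differentiableWithinAt_prism hG.contDiffOn_area hq
  have hdu : ∀ c, DifferentiableWithinAt ℝ (fun p => covVec G d a p c) prism q := fun c =>
    differentiableWithinAt_prism (hG.contDiffOn_covVec d a c) hq
  have hcross : dirDeriv prism X (fun p => cross d (covVec G d a p)) q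
      = cross d (fun c => ∑ b, dirDeriv prism X (gam G c a b) q * d b) := by
    simp only [cross]
    rw [dirDeriv_sub hS ((hdu 1).const_mul _) ((hdu 0).const_mul _),
      dirDeriv_const_mul hS _ (hdu 1), dirDeriv_const_mul hS _ (hdu 0),
      hG.dirDeriv_covVec _ _ _ _ hq, hG.dirDeriv_covVec _ _ _ _ hq]
  have hdc : DifferentiableWithinAt ℝ (fun p => cross d (covVec G d a p)) prism q :=
    ((hdu 1).const_mul _).sub ((hdu 0).const_mul _)
  have hdiv : dirDeriv prism X (conn G d a) q = _ := dirDeriv_div hS (hdr.mul hdc)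
    (differentiableWithinAt_prism (hG.contDiffOn_lenSq d) hq) hL
  rw [hdiv, dirDeriv_mul hS hdr hdc, hcross, conn]
  field_simp
  ring

theorem riemann_eq (d c a b : Fin 2) (hq : q ∈ prism) :
    riemann (G q.1) d c a b q.2 = ∂ₓ[a] (gam G d b c) q - ∂ₓ[b] (gam G d a c) q
      + ∑ e, (gam G d a e q * gam G e b c q - gam G d b e q * gam G e a c q) := by
  have hpartial : ∀ a b, partialD a (christoffel (G q.1) d b c) q.2 = ∂ₓ[a] (gam G d b c) q :=
    fun a b => partialD_slice (differentiableWithinAt_prism (hG.contDiffOn_gam d b c) hq) hq a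
  rw [riemann, hpartial, hpartial]
  rfl

theorem spaceDeriv_spaceDeriv_coef (a b c e : Fin 2) (hq : q ∈ prism) :
    ∂ₓ[a] (∂ₓ[b] (coef G c e)) q
      = ∑ d, (coef G e d q * ∂ₓ[a] (gam G d b c) q + gam G d b c q * ∂ₓ[a] (coef G e d) q
        + (coef G c d q * ∂ₓ[a] (gam G d b e) q + gam G d b e q * ∂ₓ[a] (coef G c d) q)) := by
  have hS := uniqueDiffOn_prism q hq
  have hg : ∀ a b, DifferentiableWithinAt ℝ (coef G a b) prism q := fun a b =>
    differentiableWithinAt_prism (hG.contDiffOn_coef a b) hq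
  have hΓ : ∀ d c, DifferentiableWithinAt ℝ (gam G d b c) prism q := fun d c =>
    differentiableWithinAt_prism (hG.contDiffOn_gam d b c) hq
  rw [dirDeriv_congr (fun p hp => hG.spaceDeriv_coef b c e hp) hq,
    dirDeriv_sum hS fun d _ => by fun_prop]
  refine Finset.sum_congr rfl fun d _ => ?_
  rw [dirDeriv_add hS (by fun_prop) (by fun_prop), dirDeriv_mul hS (hg e d) (hΓ d c),
    dirDeriv_mul hS (hg c d) (hΓ d e)]

theorem sum_coef_mul_riemann_skew (a b c e : Fin 2) (hq : q ∈ prism) :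
    ∑ d, coef G e d q * riemann (G q.1) d c a b q.2
      = -∑ d, coef G c d q * riemann (G q.1) d e a b q.2 := by
  have hcomm := dirDeriv_comm (X := spaceDir a) (Y := spaceDir b) uniqueDiffOn_prism
    ((hG.contDiffOn_coef c e).of_le ENat.LEInfty.out) hq
    (prism_subset_closure_interior hq)
  simp only [hG.spaceDeriv_spaceDeriv_coef _ _ _ _ hq, hG.spaceDeriv_coef _ _ _ hq,
    Fin.sum_univ_two, hG.coef_comm 1 0 hq] at hcomm
  simp only [hG.riemann_eq _ _ _ _ hq, Fin.sum_univ_two]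
  linear_combination hcomm

end MetricFamily

section Variation

variable (G : ℝ → MatField)

/-- The time derivative `σ_{ab}` of the metric coefficients. -/
def velocity (a b : Fin 2) : ℝ × Coord → ℝ := ∂ₜ (coef G a b)

/-- The covariant derivative `(∇_a σ)_{bc}` of the velocity of the metric. -/
def covDeriv (a b c : Fin 2) (q : ℝ × Coord) : ℝ :=
  ∂ₓ[a] (velocity G b c) q
    - ∑ e, (gam G e a b q * velocity G e c q + gam G e a c q * velocity G b e q)

/-- The covariant curl `(∇₀ σ)_{c1} - (∇₁ σ)_{c0}` of the velocity of the metric. -/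
def covCurl (c : Fin 2) (q : ℝ × Coord) : ℝ := covDeriv G 0 c 1 q - covDeriv G 1 c 0 q

/-- The number `-½ σ(τ, n)` for the unit vector `τ` in the direction of `d` and the unit normal `n`
to its right: the rate at which the rotation by a right angle turns against `d`, which moves the
orthonormal frame that starts with `d`. -/
def rotRate (d : Coord) (q : ℝ × Coord) : ℝ :=
  cross (fun a => ∑ b, coef G a b q * d b) (fun a => ∑ b, velocity G a b q * d b)
    / (2 * area G q * lenSq G d q)

/-- The density `½ (𝕊σ)^{ab} √det g` with raised indices, where `σ` is the velocity. In dimension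
two `𝕊σ` with raised indices is minus the adjugate of `σ` divided by `det g`. -/
def stress (a b : Fin 2) (q : ℝ × Coord) : ℝ :=
  ![![-velocity G 1 1 q, velocity G 0 1 q], ![velocity G 0 1 q, -velocity G 0 0 q]] a b
    / (2 * area G q)

/-- The covariant divergence of the tensor density `stress`. -/
def flux (a : Fin 2) (q : ℝ × Coord) : ℝ :=
  ∑ b, ∂ₓ[b] (stress G a b) q + ∑ b, ∑ c, gam G a b c q * stress G b c q

end Variation

namespace MetricFamily

variable {G : ℝ → MatField} (hG : MetricFamily G) {q : ℝ × Coord}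
include hG

theorem cross_riemann (d : Coord) (hq : q ∈ prism) :
    cross d (fun c => ∑ e, riemann (G q.1) c e 0 1 q.2 * d e)
      = -(gaussCurv (G q.1) q.2 * lenSq G d q) := by
  have hdet := hG.det_pos hq
  have h00 := hG.sum_coef_mul_riemann_skew 0 1 0 0 hq
  have h10 := hG.sum_coef_mul_riemann_skew 0 1 0 1 hq
  have h11 := hG.sum_coef_mul_riemann_skew 0 1 1 1 hq
  have hcomm : G q.1 q.2 1 0 = G q.1 q.2 0 1 := hG.coef_comm 1 0 hq
  rw [gaussCurv, div_mul_eq_mul_div, eq_neg_iff_add_eq_zero, ← mul_left_inj' hdet.ne', add_mul,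
    div_mul_cancel₀ _ hdet.ne', hG.lenSq_eq d hq, Matrix.det_fin_two]
  simp only [coef, Fin.sum_univ_two, hcomm] at h00 h10 h11 ⊢
  simp only [cross]
  linear_combination (G q.1 q.2 0 0 * d 0 + G q.1 q.2 0 1 * d 1) * (d 0 * h10 + d 1 / 2 * h11)
    - (G q.1 q.2 0 1 * d 0 + G q.1 q.2 1 1 * d 1) * d 0 / 2 * h00

theorem gaussCurv_mul_area {d : Coord} (hd : d ≠ 0) (hq : q ∈ prism) :
    gaussCurv (G q.1) q.2 * area G q = ∂ₓ[1] (conn G d 0) q - ∂ₓ[0] (conn G d 1) q := by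
  have hL := (hG.lenSq_pos hd hq).ne'
  have hK := hG.cross_riemann d hq
  have hcyclic : cross d (covVec G d 0 q) * form (G q.1 q.2) d (covVec G d 1 q)
      - cross d (covVec G d 1 q) * form (G q.1 q.2) d (covVec G d 0 q)
      = -(cross (covVec G d 0 q) (covVec G d 1 q) * lenSq G d q) := by
    simp only [lenSq, form, cross, dotProduct, Matrix.mulVec, Fin.sum_univ_two]
    ring
  have htrace : (∑ e, gam G e 1 e q) * cross d (covVec G d 0 q)
      - (∑ e, gam G e 0 e q) * cross d (covVec G d 1 q)
      + cross d (fun c => ∑ e, (gam G c 0 e q * covVec G d 1 q e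
          - gam G c 1 e q * covVec G d 0 q e))
      + 2 * cross (covVec G d 0 q) (covVec G d 1 q) = 0 := by
    simp only [covVec, cross, Fin.sum_univ_two]
    ring
  rw [← mul_left_inj' hL, sub_mul, hG.dirDeriv_conn _ hd _ hq, hG.dirDeriv_conn _ hd _ hq,
    div_mul_cancel₀ _ hL, div_mul_cancel₀ _ hL, hG.spaceDeriv_area _ hq, hG.spaceDeriv_area _ hq,
    hG.spaceDeriv_lenSq _ _ hq, hG.spaceDeriv_lenSq _ _ hq, conn, conn]
  field_simp
  simp only [hG.riemann_eq _ _ _ _ hq, cross, covVec, Fin.sum_univ_two] at hK htrace hcyclic ⊢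
  linear_combination area G q * lenSq G d q * (hK - htrace) + 2 * area G q * hcyclic

theorem contDiffOn_velocity (a b : Fin 2) : ContDiffOn ℝ ∞ (velocity G a b) prism :=
  hG.contDiffOn_dirDeriv_coef timeDir a b

theorem velocity_comm (a b : Fin 2) : EqOn (velocity G a b) (velocity G b a) prism :=
  fun _ hq => hG.dirDeriv_coef_comm timeDir a b hq

theorem timeDeriv_spaceDeriv_coef (a b c : Fin 2) (hq : q ∈ prism) :
    ∂ₜ (∂ₓ[a] (coef G b c)) q = ∂ₓ[a] (velocity G b c) q :=
  dirDeriv_comm uniqueDiffOn_prism ((hG.contDiffOn_coef b c).of_le ENat.LEInfty.out) hq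
    (prism_subset_closure_interior hq)

theorem sum_coef_mul_timeDeriv_gam (c a b : Fin 2) (hq : q ∈ prism) :
    ∑ e, coef G c e q * ∂ₜ (gam G e a b) q
      = (covDeriv G a b c q + covDeriv G b a c q - covDeriv G c a b q) / 2 := by
  have hS := uniqueDiffOn_prism q hq
  have hg : ∀ a b, DifferentiableWithinAt ℝ (coef G a b) prism q := fun a b =>
    differentiableWithinAt_prism (hG.contDiffOn_coef a b) hq
  have hΓ : ∀ e, DifferentiableWithinAt ℝ (gam G e a b) prism q := fun e =>
    differentiableWithinAt_prism (hG.contDiffOn_gam e a b) hq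
  have hdg : ∀ a b c, DifferentiableWithinAt ℝ (∂ₓ[a] (coef G b c)) prism q := fun a b c =>
    differentiableWithinAt_prism (hG.contDiffOn_dirDeriv_coef _ b c) hq
  have h := dirDeriv_congr (X := timeDir) (fun p hp => hG.sum_coef_mul_gam c a b hp) hq
  simp only [div_eq_mul_inv] at h
  rw [dirDeriv_sum hS fun e _ => by fun_prop, dirDeriv_mul_const hS _ (by fun_prop),
    dirDeriv_sub hS (by fun_prop) (hdg c a b), dirDeriv_add hS (hdg a b c) (hdg b a c)] at h
  have hvelocity : ∀ e, ∂ₜ (coef G c e) q = velocity G e c q := fun e =>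
    hG.velocity_comm c e hq
  simp only [dirDeriv_mul hS (hg c _) (hΓ _), hG.timeDeriv_spaceDeriv_coef _ _ _ hq, hvelocity,
    Finset.sum_add_distrib] at h
  rw [eq_sub_of_add_eq h]
  simp only [covDeriv, Fin.sum_univ_two, hG.gam_comm _ b a hq, hG.gam_comm _ c a hq,
    hG.gam_comm _ c b hq, hG.velocity_comm b _ hq]
  ring

end MetricFamily

theorem dirDeriv_cross {S : Set (ℝ × Coord)} {X q : ℝ × Coord} {u w : ℝ × Coord → Coord}
    (hS : UniqueDiffWithinAt ℝ S q)
    (hu : ∀ c, DifferentiableWithinAt ℝ (fun p => u p c) S q)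
    (hw : ∀ c, DifferentiableWithinAt ℝ (fun p => w p c) S q) :
    dirDeriv S X (fun p => cross (u p) (w p)) q
      = cross (fun c => dirDeriv S X (fun p => u p c) q) (w q)
        + cross (u q) (fun c => dirDeriv S X (fun p => w p c) q) := by
  simp only [cross]
  rw [dirDeriv_sub hS ((hu 0).fun_mul (hw 1)) ((hu 1).fun_mul (hw 0)),
    dirDeriv_mul hS (hu 0) (hw 1), dirDeriv_mul hS (hu 1) (hw 0)]
  ring

namespace MetricFamily

variable {G : ℝ → MatField} (hG : MetricFamily G) {q : ℝ × Coord}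
include hG

theorem area_sq_mul_cross_timeDeriv_gam (d : Coord) (a : Fin 2) (hq : q ∈ prism) :
    area G q ^ 2 * cross d (fun c => ∑ b, ∂ₜ (gam G c a b) q * d b)
      = (cross (fun c => ∑ b, coef G c b q * d b) (fun c => ∑ b, covDeriv G a b c q * d b)
          + covCurl G a q * lenSq G d q) / 2 := by
  have hpalatini := fun c b => hG.sum_coef_mul_timeDeriv_gam c a b hq
  have h00 := hpalatini 0 0
  have h01 := hpalatini 0 1
  have h10 := hpalatini 1 0
  have h11 := hpalatini 1 1
  rw [hG.area_sq hq, hG.lenSq_eq d hq, covCurl]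
  simp only [Fin.sum_univ_two, hG.coef_comm 1 0 hq, cross] at h00 h01 h10 h11 ⊢
  linear_combination (coef G 0 0 q * d 0 + coef G 0 1 q * d 1) * (d 0 * h10 + d 1 * h11)
    - (coef G 0 1 q * d 0 + coef G 1 1 q * d 1) * (d 0 * h00 + d 1 * h01)

theorem spaceDeriv_sum_coef_mul (d : Coord) (a c : Fin 2) (hq : q ∈ prism) :
    ∂ₓ[a] (fun p => ∑ b, coef G c b p * d b) q
      = ∑ b, coef G c b q * covVec G d a q b + ∑ e, gam G e a c q * ∑ b, coef G e b q * d b := by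
  have hS := uniqueDiffOn_prism q hq
  have hg : ∀ a b, DifferentiableWithinAt ℝ (coef G a b) prism q := fun a b =>
    differentiableWithinAt_prism (hG.contDiffOn_coef a b) hq
  rw [dirDeriv_sum hS fun b _ => by fun_prop]
  simp only [dirDeriv_mul_const hS _ (hg _ _), hG.spaceDeriv_coef _ _ _ hq, covVec,
    Fin.sum_univ_two, hG.coef_comm 1 0 hq]
  ring

theorem spaceDeriv_sum_velocity_mul (d : Coord) (a c : Fin 2) (hq : q ∈ prism) :
    ∂ₓ[a] (fun p => ∑ b, velocity G c b p * d b) q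
      = ∑ b, velocity G c b q * covVec G d a q b + ∑ e, gam G e a c q * ∑ b, velocity G e b q * d b
        + ∑ b, covDeriv G a b c q * d b := by
  have hS := uniqueDiffOn_prism q hq
  have hσ : ∀ a b, DifferentiableWithinAt ℝ (velocity G a b) prism q := fun a b =>
    differentiableWithinAt_prism (hG.contDiffOn_velocity a b) hq
  have hcomm : ∀ b, ∂ₓ[a] (velocity G c b) q = ∂ₓ[a] (velocity G b c) q := fun b =>
    dirDeriv_congr (hG.velocity_comm c b) hq
  rw [dirDeriv_sum hS fun b _ => by fun_prop]
  simp only [dirDeriv_mul_const hS _ (hσ _ _), covDeriv, covVec, hcomm, Fin.sum_univ_two,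
    hG.velocity_comm c _ hq, hG.velocity_comm 1 0 hq]
  ring

theorem spaceDeriv_rotRate {d : Coord} (hd : d ≠ 0) (a : Fin 2) (hq : q ∈ prism) :
    2 * area G q * lenSq G d q ^ 2 * ∂ₓ[a] (rotRate G d) q
      = lenSq G d q * (
          cross (fun c => ∑ b, coef G c b q * covVec G d a q b)
            (fun c => ∑ b, velocity G c b q * d b)
          + cross (fun c => ∑ b, coef G c b q * d b)
            (fun c => ∑ b, velocity G c b q * covVec G d a q b)
          + cross (fun c => ∑ b, coef G c b q * d b) (fun c => ∑ b, covDeriv G a b c q * d b))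
        - 2 * cross (fun c => ∑ b, coef G c b q * d b) (fun c => ∑ b, velocity G c b q * d b)
          * form (G q.1 q.2) d (covVec G d a q) := by
  have hS := uniqueDiffOn_prism q hq
  have hr := (hG.area_pos hq).ne'
  have hL := (hG.lenSq_pos hd hq).ne'
  have hdr := differentiableWithinAt_prism hG.contDiffOn_area hq
  have hdL := differentiableWithinAt_prism (hG.contDiffOn_lenSq d) hq
  have hg : ∀ c, DifferentiableWithinAt ℝ (fun p => ∑ b, coef G c b p * d b) prism q := fun c =>
    .fun_sum fun b _ => (differentiableWithinAt_prism (hG.contDiffOn_coef c b) hq).mul_const _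
  have hσ : ∀ c, DifferentiableWithinAt ℝ (fun p => ∑ b, velocity G c b p * d b) prism q :=
    fun c => .fun_sum fun b _ =>
      (differentiableWithinAt_prism (hG.contDiffOn_velocity c b) hq).mul_const _
  have hdiv : ∂ₓ[a] (rotRate G d) q = _ := dirDeriv_div hS
    (((hg 0).mul (hσ 1)).sub ((hg 1).mul (hσ 0))) ((hdr.const_mul 2).mul hdL)
    (mul_ne_zero (mul_ne_zero two_ne_zero hr) hL)
  rw [hdiv, dirDeriv_cross hS hg hσ, dirDeriv_mul hS (hdr.const_mul 2) hdL,
    dirDeriv_const_mul hS _ hdr, hG.spaceDeriv_area a hq, hG.spaceDeriv_lenSq d a hq]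
  simp only [hG.spaceDeriv_sum_coef_mul d a _ hq, hG.spaceDeriv_sum_velocity_mul d a _ hq]
  field_simp
  simp only [cross, Fin.sum_univ_two]
  ring

theorem timeDeriv_conn {d : Coord} (hd : d ≠ 0) (a : Fin 2) (hq : q ∈ prism) :
    ∂ₜ (conn G d a) q = covCurl G a q / (2 * area G q) + ∂ₓ[a] (rotRate G d) q := by
  have hr := (hG.area_pos hq).ne'
  have hL := (hG.lenSq_pos hd hq).ne'
  have hρ := hG.spaceDeriv_rotRate hd a hq
  have hU := hG.area_sq_mul_cross_timeDeriv_gam d a hq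
  have hform : form (G q.1 q.2) d (covVec G d a q)
      = ∑ c, ∑ b, coef G c b q * covVec G d a q b * d c := by
    simp only [form, coef, dotProduct, Matrix.mulVec, Fin.sum_univ_two]
    ring
  have hrot : cross d (covVec G d a q) * (lenSq G d q * (coef G 1 1 q * velocity G 0 0 q
        + coef G 0 0 q * velocity G 1 1 q - 2 * coef G 0 1 q * velocity G 0 1 q)
        - 2 * area G q ^ 2 * ∂ₜ (lenSq G d) q)
      = lenSq G d q * (
          cross (fun c => ∑ b, coef G c b q * covVec G d a q b)
            (fun c => ∑ b, velocity G c b q * d b)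
          + cross (fun c => ∑ b, coef G c b q * d b)
            (fun c => ∑ b, velocity G c b q * covVec G d a q b))
        - 2 * cross (fun c => ∑ b, coef G c b q * d b) (fun c => ∑ b, velocity G c b q * d b)
          * form (G q.1 q.2) d (covVec G d a q) := by
    rw [hform, hG.dirDeriv_lenSq _ _ hq, hG.area_sq hq, hG.lenSq_eq d hq]
    simp only [cross, Fin.sum_univ_two, hG.coef_comm 1 0 hq, hG.velocity_comm 1 0 hq]
    simp only [velocity]
    ring
  have harea : ∂ₜ (area G) q = (coef G 1 1 q * velocity G 0 0 q
      + coef G 0 0 q * velocity G 1 1 q - 2 * coef G 0 1 q * velocity G 0 1 q) / (2 * area G q) :=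
    hG.dirDeriv_area _ hq
  rw [hG.dirDeriv_conn _ hd _ hq, harea, conn, ← sub_eq_zero,
    ← mul_left_inj' (mul_ne_zero (mul_ne_zero two_ne_zero hr) (pow_ne_zero 2 hL))]
  field_simp
  linear_combination hrot + 2 * lenSq G d q * hU - hρ

theorem contDiffOn_rotRate {d : Coord} (hd : d ≠ 0) : ContDiffOn ℝ ∞ (rotRate G d) prism := by
  have hg : ∀ c, ContDiffOn ℝ ∞ (fun p => ∑ b, coef G c b p * d b) prism := fun c =>
    ContDiffOn.sum fun b _ => (hG.contDiffOn_coef c b).mul contDiffOn_const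
  have hσ : ∀ c, ContDiffOn ℝ ∞ (fun p => ∑ b, velocity G c b p * d b) prism := fun c =>
    ContDiffOn.sum fun b _ => (hG.contDiffOn_velocity c b).mul contDiffOn_const
  refine (((hg 0).mul (hσ 1)).sub ((hg 1).mul (hσ 0))).div
    ((contDiffOn_const.mul hG.contDiffOn_area).mul (hG.contDiffOn_lenSq d)) fun p hp => ?_
  have := hG.area_pos hp
  have := hG.lenSq_pos hd hp
  positivity

theorem contDiffOn_div_area {f : ℝ × Coord → ℝ} (hf : ContDiffOn ℝ ∞ f prism) :
    ContDiffOn ℝ ∞ (fun p => f p / (2 * area G p)) prism :=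
  hf.div (contDiffOn_const.mul hG.contDiffOn_area) fun _ hp =>
    mul_ne_zero two_ne_zero (hG.area_pos hp).ne'

theorem contDiffOn_stress (a b : Fin 2) : ContDiffOn ℝ ∞ (stress G a b) prism := by
  have hσ := hG.contDiffOn_velocity
  fin_cases a <;> fin_cases b
  exacts [hG.contDiffOn_div_area (hσ 1 1).neg, hG.contDiffOn_div_area (hσ 0 1),
    hG.contDiffOn_div_area (hσ 0 1), hG.contDiffOn_div_area (hσ 0 0).neg]

theorem contDiffOn_flux (a : Fin 2) : ContDiffOn ℝ ∞ (flux G a) prism :=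
  (ContDiffOn.sum fun b _ =>
    contDiffOn_dirDeriv uniqueDiffOn_prism (hG.contDiffOn_stress a b) (by simp)).add
    (ContDiffOn.sum fun b _ => ContDiffOn.sum fun c _ =>
      (hG.contDiffOn_gam a b c).mul (hG.contDiffOn_stress b c))

theorem spaceDeriv_div_area {f : ℝ × Coord → ℝ} (hf : DifferentiableWithinAt ℝ f prism q)
    (a : Fin 2) (hq : q ∈ prism) :
    ∂ₓ[a] (fun p => f p / (2 * area G p)) q
      = (∂ₓ[a] f q - f q * ∑ e, gam G e a e q) / (2 * area G q) := by
  have hS := uniqueDiffOn_prism q hq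
  have hr := (hG.area_pos hq).ne'
  have hdr := differentiableWithinAt_prism hG.contDiffOn_area hq
  rw [dirDeriv_div hS hf (hdr.const_mul 2) (mul_ne_zero two_ne_zero hr),
    dirDeriv_const_mul hS _ hdr, hG.spaceDeriv_area a hq]
  field_simp

theorem spaceDeriv_stress (a b c : Fin 2) (hq : q ∈ prism) :
    ∂ₓ[c] (stress G a b) q
      = ![![-∂ₓ[c] (velocity G 1 1) q, ∂ₓ[c] (velocity G 0 1) q],
          ![∂ₓ[c] (velocity G 0 1) q, -∂ₓ[c] (velocity G 0 0) q]] a b / (2 * area G q)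
        - stress G a b q * ∑ e, gam G e c e q := by
  have hσ : ∀ a b, DifferentiableWithinAt ℝ (velocity G a b) prism q := fun a b =>
    differentiableWithinAt_prism (hG.contDiffOn_velocity a b) hq
  have hneg : ∀ a, ∂ₓ[c] (fun p => -velocity G a a p) q = -∂ₓ[c] (velocity G a a) q := fun a =>
    by simpa using dirDeriv_const_mul (X := spaceDir c) (uniqueDiffOn_prism q hq) (-1) (hσ a a)
  have h01 := hG.spaceDeriv_div_area (hσ 0 1) c hq
  have hdiag := fun a => hG.spaceDeriv_div_area (hσ a a).fun_neg c hq
  simp only [hneg, sub_div, mul_div_right_comm] at h01 hdiag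
  fin_cases a <;> fin_cases b
  exacts [hdiag 1, h01, h01, hdiag 0]

theorem flux_eq (hq : q ∈ prism) :
    flux G 0 q = -(covCurl G 1 q / (2 * area G q)) ∧
      flux G 1 q = covCurl G 0 q / (2 * area G q) := by
  have hr := (hG.area_pos hq).ne'
  have hcomm : ∀ a, ∂ₓ[a] (velocity G 1 0) q = ∂ₓ[a] (velocity G 0 1) q := fun a =>
    dirDeriv_congr (hG.velocity_comm 1 0) hq
  constructor <;>
  · simp only [flux, hG.spaceDeriv_stress _ _ _ hq, stress, covCurl, covDeriv, hcomm,
      Fin.sum_univ_two, hG.velocity_comm 1 0 hq, hG.gam_comm _ 1 0 hq, Matrix.cons_val_zero,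
      Matrix.cons_val_one]
    field_simp
    ring

theorem timeDeriv_gaussCurv_mul_area (hq : q ∈ prism) :
    ∂ₜ (fun p => gaussCurv (G p.1) p.2 * area G p) q = ∑ a, ∂ₓ[a] (flux G a) q := by
  obtain ⟨d, hd⟩ := exists_ne (0 : Coord)
  have hS := uniqueDiffOn_prism q hq
  have hω : ∀ a b, DifferentiableWithinAt ℝ (∂ₓ[b] (conn G d a)) prism q := fun a b =>
    differentiableWithinAt_prism
      (contDiffOn_dirDeriv uniqueDiffOn_prism (hG.contDiffOn_conn hd a) (by simp)) hq
  have hφ : ∀ a, DifferentiableWithinAt ℝ (flux G a) prism q := fun a =>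
    differentiableWithinAt_prism (hG.contDiffOn_flux a) hq
  have hρ : ∀ a, DifferentiableWithinAt ℝ (∂ₓ[a] (rotRate G d)) prism q := fun a =>
    differentiableWithinAt_prism
      (contDiffOn_dirDeriv uniqueDiffOn_prism (hG.contDiffOn_rotRate hd) (by simp)) hq
  have hcomm : ∀ {f : ℝ × Coord → ℝ} (X Y : ℝ × Coord), ContDiffOn ℝ ∞ f prism →
      dirDeriv prism X (dirDeriv prism Y f) q = dirDeriv prism Y (dirDeriv prism X f) q :=
    fun X Y hf => dirDeriv_comm uniqueDiffOn_prism (hf.of_le ENat.LEInfty.out) hq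
      (prism_subset_closure_interior hq)
  have h0 : EqOn (∂ₜ (conn G d 0)) (fun p => flux G 1 p + ∂ₓ[0] (rotRate G d) p) prism :=
    fun p hp => by simp only [hG.timeDeriv_conn hd 0 hp, (hG.flux_eq hp).2]
  have h1 : EqOn (∂ₜ (conn G d 1)) (fun p => ∂ₓ[1] (rotRate G d) p - flux G 0 p) prism :=
    fun p hp => by simp only [hG.timeDeriv_conn hd 1 hp, (hG.flux_eq hp).1]; ring
  rw [dirDeriv_congr (fun p hp => hG.gaussCurv_mul_area hd hp) hq,
    dirDeriv_sub hS (hω 0 1) (hω 1 0),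
    hcomm _ _ (hG.contDiffOn_conn hd 0), hcomm _ _ (hG.contDiffOn_conn hd 1),
    dirDeriv_congr h0 hq, dirDeriv_congr h1 hq, dirDeriv_add hS (hφ 1) (hρ 0),
    dirDeriv_sub hS (hρ 1) (hφ 0), hcomm (spaceDir 1) _ (hG.contDiffOn_rotRate hd),
    Fin.sum_univ_two]
  ring

end MetricFamily

section SymmetricMatrices

variable {A : Matrix (Fin 2) (Fin 2) ℝ} (hA : A.IsSymm)
include hA

theorem tensorInner_eq_sum_inv_mul_mul_inv (B C : Matrix (Fin 2) (Fin 2) ℝ) :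
    tensorInner A B C = ∑ a, ∑ b, (A⁻¹ * B * A⁻¹) a b * C a b := by
  have hinv : A⁻¹ 1 0 = A⁻¹ 0 1 := hA.inv.apply 0 1
  simp only [tensorInner, Matrix.mul_apply, Fin.sum_univ_two, hinv]
  ring

theorem form_inv_mulVec (B : Matrix (Fin 2) (Fin 2) ℝ) (u w : Coord) :
    form B (A⁻¹ *ᵥ u) (A⁻¹ *ᵥ w) = form (A⁻¹ * B * A⁻¹) u w := by
  rw [form, form, ← Matrix.mulVec_mulVec, ← Matrix.mulVec_mulVec, Matrix.dotProduct_mulVec u,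
    ← Matrix.mulVec_transpose, hA.inv.eq]

/- With `m = A⁻¹ B` this is the Cayley–Hamilton identity `m - tr m = -adj m`. -/
theorem inv_mul_opS_mul_inv (hdet : A.det ≠ 0) (B : Matrix (Fin 2) (Fin 2) ℝ) :
    A⁻¹ * opS A B * A⁻¹ = -(A.det⁻¹ • B.adjugate) := by
  have hcancel : A⁻¹ * A = 1 := A.nonsing_inv_mul hdet.isUnit
  have htrace : metricTrace A B = (A⁻¹ * B).trace := by
    simp only [metricTrace, Matrix.trace, Matrix.diag, Matrix.mul_apply]
    rw [Finset.sum_comm]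
    exact Finset.sum_congr rfl fun b _ => Finset.sum_congr rfl fun a _ => by rw [hA.inv.apply]
  have hcayley : ∀ m : Matrix (Fin 2) (Fin 2) ℝ, m - m.trace • 1 = -m.adjugate := fun m => by
    rw [Matrix.adjugate_fin_two]
    ext a b
    fin_cases a <;> fin_cases b <;> simp [Matrix.trace_fin_two]
  calc A⁻¹ * opS A B * A⁻¹ = (A⁻¹ * B - (A⁻¹ * B).trace • 1) * A⁻¹ := by
        rw [opS, htrace, mul_sub, Matrix.mul_smul, hcancel]
    _ = -(B.adjugate * ((A⁻¹).adjugate * A⁻¹)) := by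
        rw [hcayley, Matrix.adjugate_mul_distrib, neg_mul, mul_assoc]
    _ = -(A.det⁻¹ • B.adjugate) := by
        rw [Matrix.adjugate_mul, Matrix.det_nonsing_inv, Ring.inverse_eq_inv', Matrix.mul_smul,
          mul_one]

end SymmetricMatrices

theorem form_neg_right (A : Matrix (Fin 2) (Fin 2) ℝ) (u w : Coord) :
    form A u (-w) = -form A u w := by
  rw [form, form, Matrix.mulVec_neg, dotProduct_neg]

namespace MetricFamily

variable {G : ℝ → MatField} (hG : MetricFamily G) {q : ℝ × Coord}
include hG

theorem isSymm (hq : q ∈ prism) : (G q.1 q.2).IsSymm := (hG.posDef q hq).1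

theorem det_eq_area_sq (hq : q ∈ prism) : (G q.1 q.2).det = area G q ^ 2 :=
  (Real.sq_sqrt (hG.det_pos hq).le).symm

theorem inv_mulVec_sideConormal (k : Fin 3) (hq : q ∈ prism) :
    (G q.1 q.2)⁻¹ *ᵥ sideConormal k
      = (area G q ^ 2)⁻¹ •
        ![∑ b, coef G 1 b q * sideDir k b, -∑ b, coef G 0 b q * sideDir k b] := by
  rw [Matrix.inv_def, Ring.inverse_eq_inv', hG.det_eq_area_sq hq, Matrix.adjugate_fin_two,
    Matrix.smul_mulVec]
  congr 1
  ext a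
  have hcomm : G q.1 q.2 1 0 = G q.1 q.2 0 1 := hG.coef_comm 1 0 hq
  fin_cases a <;> simp [sideConormal, Matrix.mulVec, dotProduct, coef, hcomm]; ring

theorem form_inv_sideConormal (k : Fin 3) (hq : q ∈ prism) :
    form (G q.1 q.2)⁻¹ (sideConormal k) (sideConormal k)
      = lenSq G (sideDir k) q / area G q ^ 2 := by
  rw [form, hG.inv_mulVec_sideConormal k hq, hG.lenSq_eq _ hq]
  simp only [sideConormal, dotProduct, Fin.sum_univ_two, hG.coef_comm 1 0 hq, Pi.smul_apply,
    Matrix.cons_val_zero, Matrix.cons_val_one, smul_eq_mul]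
  ring

theorem unitNormal_eq (k : Fin 3) (hq : q ∈ prism) :
    unitNormal (G q.1 q.2) k = (area G q * √(lenSq G (sideDir k) q))⁻¹ •
      ![∑ b, coef G 1 b q * sideDir k b, -∑ b, coef G 0 b q * sideDir k b] := by
  have hr := hG.area_pos hq
  rw [unitNormal, hG.form_inv_sideConormal k hq, hG.inv_mulVec_sideConormal k hq, smul_smul,
    Real.sqrt_div' _ (sq_nonneg _), Real.sqrt_sq hr.le]
  congr 1
  have := (Real.sqrt_pos.2 (hG.lenSq_pos (sideDir_ne_zero k) hq)).ne'
  field_simp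

theorem form_unitNormal (k : Fin 3) (w : Coord) (hq : q ∈ prism) :
    form (G q.1 q.2) w (unitNormal (G q.1 q.2) k)
      = -(area G q * cross (sideDir k) w / √(lenSq G (sideDir k) q)) := by
  have hr := hG.area_pos hq
  have hr2 := hG.area_sq hq
  have hcomm : G q.1 q.2 1 0 = G q.1 q.2 0 1 := hG.coef_comm 1 0 hq
  have := (Real.sqrt_pos.2 (hG.lenSq_pos (sideDir_ne_zero k) hq)).ne'
  rw [hG.unitNormal_eq k hq, form, Matrix.mulVec_smul, dotProduct_smul, smul_eq_mul]
  simp only [coef, dotProduct, Matrix.mulVec, cross, Fin.sum_univ_two, hcomm,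
    Matrix.cons_val_zero, Matrix.cons_val_one] at hr2 ⊢
  field_simp
  rw [hr2]
  ring

theorem geodCurv_mul_sideSpeed (k : Fin 3) (hq : q ∈ prism) :
    geodCurv (G q.1) k q.2 * sideSpeed (G q.1 q.2) k
      = ∑ a, sideDir k a * conn G (sideDir k) a q := by
  have hL := hG.lenSq_pos (sideDir_ne_zero k) hq
  have hs := (Real.sqrt_pos.2 hL).ne'
  have hspeed : sideSpeed (G q.1 q.2) k = √(lenSq G (sideDir k) q) := rfl
  have hacc : (fun c => ∑ a, ∑ b, christoffel (G q.1) c a b q.2 * sideDir k a * sideDir k b)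
      = fun c => ∑ a, sideDir k a * covVec G (sideDir k) a q c := by
    simp only [covVec, gam, Finset.mul_sum, mul_left_comm, mul_assoc]
  rw [geodCurv, hacc, form_neg_right, hG.form_unitNormal k _ hq, hspeed, Real.sq_sqrt hL.le]
  simp only [conn, cross, Fin.sum_univ_two]
  field_simp
  ring

theorem timeDeriv_geodCurv_mul_sideSpeed (k : Fin 3) (hq : q ∈ prism) :
    ∂ₜ (fun p => geodCurv (G p.1) k p.2 * sideSpeed (G p.1 p.2) k) q
      = ∑ a, sideDir k a * ∂ₓ[a] (rotRate G (sideDir k)) q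
        - ∑ a, flux G a q * sideConormal k a := by
  have hd := sideDir_ne_zero k
  have hω : ∀ a, DifferentiableWithinAt ℝ (conn G (sideDir k) a) prism q := fun a =>
    differentiableWithinAt_prism (hG.contDiffOn_conn hd a) hq
  rw [dirDeriv_congr (fun p hp => hG.geodCurv_mul_sideSpeed k hp) hq,
    dirDeriv_sum (uniqueDiffOn_prism q hq) fun a _ => (hω a).const_mul _]
  simp only [dirDeriv_const_mul (uniqueDiffOn_prism q hq) _ (hω _), Fin.sum_univ_two,
    hG.timeDeriv_conn hd _ hq, (hG.flux_eq hq).1, (hG.flux_eq hq).2, sideConormal,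
    Matrix.cons_val_zero, Matrix.cons_val_one]
  ring

theorem contDiffOn_geodCurv_mul_sideSpeed (k : Fin 3) :
    ContDiffOn ℝ ∞ (fun p => geodCurv (G p.1) k p.2 * sideSpeed (G p.1 p.2) k) prism :=
  (ContDiffOn.sum fun a _ => contDiffOn_const.mul
    (hG.contDiffOn_conn (sideDir_ne_zero k) a)).congr fun _ hp => hG.geodCurv_mul_sideSpeed k hp

theorem inv_mul_opS_velocity_mul_inv (hq : q ∈ prism) (a b : Fin 2) :
    ((G q.1 q.2)⁻¹ * opS (G q.1 q.2) (Matrix.of fun a b => velocity G a b q) * (G q.1 q.2)⁻¹) a b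
      = 2 / area G q * stress G a b q := by
  have hr := (hG.area_pos hq).ne'
  have hcomm : velocity G 1 0 q = velocity G 0 1 q := hG.velocity_comm 1 0 hq
  rw [inv_mul_opS_mul_inv (hG.isSymm hq) (hG.det_pos hq).ne', hG.det_eq_area_sq hq,
    Matrix.adjugate_fin_two, stress]
  fin_cases a <;> fin_cases b <;> simp [hcomm] <;> field_simp

theorem tensorInner_opS_velocity (B : Matrix (Fin 2) (Fin 2) ℝ) (hq : q ∈ prism) :
    tensorInner (G q.1 q.2) (opS (G q.1 q.2) (Matrix.of fun a b => velocity G a b q)) B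
        * areaDensity (G q.1) q.2
      = 2 * ∑ a, ∑ b, stress G a b q * B a b := by
  have hr : area G q ≠ 0 := (hG.area_pos hq).ne'
  rw [tensorInner_eq_sum_inv_mul_mul_inv (hG.isSymm hq)]
  change _ * area G q = _
  simp only [hG.inv_mul_opS_velocity_mul_inv hq, Fin.sum_univ_two]
  field_simp

theorem form_opS_velocity_unitNormal (k : Fin 3) (hq : q ∈ prism) :
    form (opS (G q.1 q.2) (Matrix.of fun a b => velocity G a b q)) (unitNormal (G q.1 q.2) k)
        (unitNormal (G q.1 q.2) k)
      = -((∑ a, ∑ b, velocity G a b q * sideDir k a * sideDir k b) / lenSq G (sideDir k) q) := by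
  have hr := (hG.area_pos hq).ne'
  have hL := hG.lenSq_pos (sideDir_ne_zero k) hq
  have hcomm : velocity G 1 0 q = velocity G 0 1 q := hG.velocity_comm 1 0 hq
  rw [unitNormal, hG.form_inv_sideConormal k hq]
  simp only [form, Matrix.mulVec_smul, smul_dotProduct, dotProduct_smul, smul_eq_mul]
  rw [← form, form_inv_mulVec (hG.isSymm hq), ← mul_assoc, ← sq, inv_pow,
    Real.sq_sqrt (by positivity)]
  simp only [form, dotProduct, Matrix.mulVec, Fin.sum_univ_two, sideConormal, stress, hcomm,
    hG.inv_mul_opS_velocity_mul_inv hq, Matrix.cons_val_zero, Matrix.cons_val_one]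
  field_simp
  ring

theorem form_opS_velocity_mul_apply_unitNormal (k : Fin 3) (l : Coord →L[ℝ] ℝ) (hq : q ∈ prism) :
    form (opS (G q.1 q.2) (Matrix.of fun a b => velocity G a b q)) (unitNormal (G q.1 q.2) k)
        (unitNormal (G q.1 q.2) k) * l (unitNormal (G q.1 q.2) k) * sideSpeed (G q.1 q.2) k
      = 2 * (∑ a, (∑ b, stress G a b q * l (Pi.single b 1)) * sideConormal k a
          + rotRate G (sideDir k) q * l (sideDir k)) := by
  have hr := (hG.area_pos hq).ne'
  have hL := hG.lenSq_pos (sideDir_ne_zero k) hq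
  have hs := (Real.sqrt_pos.2 hL).ne'
  have hlen := hG.lenSq_eq (sideDir k) hq
  have hspeed : sideSpeed (G q.1 q.2) k = √(lenSq G (sideDir k) q) := rfl
  have hl : ∀ u : Coord, l u = u 0 * l (Pi.single 0 1) + u 1 * l (Pi.single 1 1) := fun u => by
    conv_lhs => rw [pi_eq_sum_univ' u]
    simp [Fin.sum_univ_two]
  rw [hG.form_opS_velocity_unitNormal k hq, hG.unitNormal_eq k hq, map_smul, hl ![_, _],
    hl (sideDir k), hspeed, rotRate, smul_eq_mul]
  simp only [cross, stress, sideConormal, Fin.sum_univ_two, hG.coef_comm 1 0 hq,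
    hG.velocity_comm 1 0 hq, Matrix.cons_val_zero, Matrix.cons_val_one]
  field_simp
  rw [hlen]
  ring

section Corner

/-- The cosine of the angle between the constant vector fields `u` and `w`. -/
def cosAngle (G : ℝ → MatField) (u w : Coord) (q : ℝ × Coord) : ℝ :=
  (∑ a, u a * ∑ b, coef G a b q * w b) / (√(lenSq G u q) * √(lenSq G w q))

variable {u w : Coord}

omit hG in
theorem lenSq_neg : lenSq G (-u) q = lenSq G u q := by
  simp only [lenSq, form, Matrix.mulVec_neg, dotProduct_neg, neg_dotProduct, neg_neg]

omit hG in
theorem rotRate_neg : rotRate G (-u) q = rotRate G u q := by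
  simp only [rotRate, lenSq_neg, cross, Pi.neg_apply, mul_neg, Finset.sum_neg_distrib]
  ring

theorem contDiffOn_cosAngle (hu : u ≠ 0) (hw : w ≠ 0) :
    ContDiffOn ℝ ∞ (cosAngle G u w) prism := by
  have hroot : ∀ {d}, d ≠ 0 → ContDiffOn ℝ ∞ (fun q => √(lenSq G d q)) prism := fun hd =>
    (hG.contDiffOn_lenSq _).sqrt fun _ hq => (hG.lenSq_pos hd hq).ne'
  refine ContDiffOn.div (ContDiffOn.sum fun a _ => contDiffOn_const.mul
    (ContDiffOn.sum fun b _ => (hG.contDiffOn_coef a b).mul contDiffOn_const))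
    ((hroot hu).mul (hroot hw)) fun q hq => ?_
  have hLu := hG.lenSq_pos hu hq
  have hLw := hG.lenSq_pos hw hq
  positivity

theorem one_sub_cosAngle_sq (hu : u ≠ 0) (hw : w ≠ 0) (hq : q ∈ prism) :
    1 - cosAngle G u w q ^ 2
      = (area G q * cross u w) ^ 2 / (lenSq G u q * lenSq G w q) := by
  have hLu := hG.lenSq_pos hu hq
  have hLw := hG.lenSq_pos hw hq
  rw [cosAngle, div_pow, mul_pow, Real.sq_sqrt hLu.le, Real.sq_sqrt hLw.le,
    one_sub_div (mul_pos hLu hLw).ne', mul_pow, hG.area_sq hq, hG.lenSq_eq u hq, hG.lenSq_eq w hq]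
  simp only [cross, Fin.sum_univ_two, hG.coef_comm 1 0 hq]
  ring

theorem cross_mul_cross_velocity (u w : Coord) (hq : q ∈ prism) :
    cross u w * cross (fun a => ∑ b, coef G a b q * u b) (fun a => ∑ b, velocity G a b q * u b)
      = lenSq G u q * (∑ a, u a * ∑ b, velocity G a b q * w b)
        - (∑ a, u a * ∑ b, coef G a b q * w b) * ∂ₜ (lenSq G u) q := by
  have hvel : ∂ₜ (coef G 1 0) q = ∂ₜ (coef G 0 1) q := hG.velocity_comm 1 0 hq
  rw [hG.dirDeriv_lenSq _ _ hq, hG.lenSq_eq _ hq]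
  simp only [cross, velocity, Fin.sum_univ_two, hG.coef_comm 1 0 hq, hvel]
  ring

theorem timeDeriv_cosAngle (hu : u ≠ 0) (hw : w ≠ 0) (hq : q ∈ prism) :
    ∂ₜ (cosAngle G u w) q
      = -(area G q * cross u w / (√(lenSq G u q) * √(lenSq G w q))
          * (rotRate G w q - rotRate G u q)) := by
  have hS := uniqueDiffOn_prism q hq
  have hr := (hG.area_pos hq).ne'
  have hLu := hG.lenSq_pos hu hq
  have hLw := hG.lenSq_pos hw hq
  have hsu := (Real.sqrt_pos.2 hLu).ne'
  have hsw := (Real.sqrt_pos.2 hLw).ne'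
  have hg : ∀ a b, DifferentiableWithinAt ℝ (coef G a b) prism q := fun a b =>
    differentiableWithinAt_prism (hG.contDiffOn_coef a b) hq
  have hlen : ∀ d, DifferentiableWithinAt ℝ (lenSq G d) prism q := fun d =>
    differentiableWithinAt_prism (hG.contDiffOn_lenSq d) hq
  have hvel : ∂ₜ (coef G 1 0) q = ∂ₜ (coef G 0 1) q := hG.velocity_comm 1 0 hq
  have hprod : ∂ₜ (fun p => ∑ a, u a * ∑ b, coef G a b p * w b) q
      = ∑ a, u a * ∑ b, velocity G a b q * w b := by
    rw [dirDeriv_sum hS fun a _ => by fun_prop]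
    refine Finset.sum_congr rfl fun a _ => ?_
    rw [dirDeriv_const_mul hS _ (by fun_prop), dirDeriv_sum hS fun b _ => by fun_prop]
    simp only [dirDeriv_mul_const hS _ (hg _ _), velocity]
  have hlagrange_u := hG.cross_mul_cross_velocity u w hq
  have hlagrange_w : cross u w
        * cross (fun a => ∑ b, coef G a b q * w b) (fun a => ∑ b, velocity G a b q * w b)
      = (∑ a, u a * ∑ b, coef G a b q * w b) * ∂ₜ (lenSq G w) q
        - lenSq G w q * (∑ a, u a * ∑ b, velocity G a b q * w b) := by
    rw [hG.dirDeriv_lenSq _ _ hq, hG.lenSq_eq _ hq]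
    simp only [cross, velocity, Fin.sum_univ_two, hG.coef_comm 1 0 hq, hvel]
    ring
  unfold cosAngle
  rw [dirDeriv_div hS (by fun_prop) (((hlen u).sqrt hLu.ne').fun_mul ((hlen w).sqrt hLw.ne'))
    (mul_ne_zero hsu hsw), dirDeriv_mul hS ((hlen u).sqrt hLu.ne') ((hlen w).sqrt hLw.ne'),
    dirDeriv_sqrt hS (hlen u) hLu.ne', dirDeriv_sqrt hS (hlen w) hLw.ne', hprod, rotRate, rotRate]
  have hsu2 := Real.sq_sqrt hLu.le
  have hsw2 := Real.sq_sqrt hLw.le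
  field_simp
  rw [hsu2, hsw2]
  linear_combination lenSq G u q * lenSq G w q
    * (lenSq G u q * hlagrange_w - lenSq G w q * hlagrange_u)

theorem hasDerivWithinAt_arccos_cosAngle (hu : u ≠ 0) (hw : w ≠ 0) (hcross : 0 < cross u w)
    (hq : q ∈ prism) :
    HasDerivWithinAt (fun s => Real.arccos (cosAngle G u w (s, q.2)))
      (rotRate G w q - rotRate G u q) (Icc 0 1) q.1 := by
  have hLu := hG.lenSq_pos hu hq
  have hLw := hG.lenSq_pos hw hq
  have hr := hG.area_pos hq
  have hsin := hG.one_sub_cosAngle_sq hu hw hq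
  have hpos : 0 < 1 - cosAngle G u w q ^ 2 := by rw [hsin]; positivity
  have harccos := Real.hasDerivAt_arccos (x := cosAngle G u w q) (fun h => by simp [h] at hpos)
    (fun h => by simp [h] at hpos)
  refine (harccos.comp_hasDerivWithinAt q.1
    (hasDerivWithinAt_time
    (differentiableWithinAt_prism (hG.contDiffOn_cosAngle hu hw) hq) hq)).congr_deriv ?_
  have hroot : √(1 - cosAngle G u w q ^ 2)
      = area G q * cross u w / (√(lenSq G u q) * √(lenSq G w q)) := by
    rw [hsin, Real.sqrt_div (sq_nonneg _), Real.sqrt_sq (by positivity), Real.sqrt_mul hLu.le]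
  have hsu := (Real.sqrt_pos.2 hLu).ne'
  have hsw := (Real.sqrt_pos.2 hLw).ne'
  rw [hroot, hG.timeDeriv_cosAngle hu hw hq]
  field_simp

end Corner

omit hG in
theorem interiorAngle_eq (k : Fin 3) (t : ℝ) :
    interiorAngle (G t) k
      = Real.arccos (cosAngle G (sideDir k) (-sideDir (k + 2)) (t, refVertex k)) := by
  rw [interiorAngle, unitTangent, unitTangent, form_neg_right, cosAngle, lenSq_neg]
  simp only [form, sideSpeed, lenSq, coef, dotProduct, Matrix.mulVec, Fin.sum_univ_two,
    Pi.smul_apply, Pi.neg_apply, smul_eq_mul]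
  congr 1
  ring

theorem hasDerivWithinAt_interiorAngle (k : Fin 3) {t : ℝ} (ht : t ∈ Icc (0 : ℝ) 1) :
    HasDerivWithinAt (fun s => interiorAngle (G s) k)
      (rotRate G (sideDir (k + 2)) (t, refVertex k) - rotRate G (sideDir k) (t, refVertex k))
      (Icc 0 1) t := by
  have hcross : 0 < cross (sideDir k) (-sideDir (k + 2)) := by
    fin_cases k <;> simp [cross, sideDir_eq]
  simpa only [← interiorAngle_eq, rotRate_neg] using
    hG.hasDerivWithinAt_arccos_cosAngle (q := (t, refVertex k)) (sideDir_ne_zero k)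
      (neg_ne_zero.2 (sideDir_ne_zero (k + 2))) hcross ⟨ht, refVertex_mem k⟩

end MetricFamily

/-- The contribution of one triangle to the distributional curvature: `∫ w K dA` over the triangle,
plus `∫ w k ds` over its sides, minus the interior angles weighted by `w`. -/
def triangleCurv (G : MatField) (w : Coord → ℝ) : ℝ :=
  (∫ x in refTriangle, w x * (gaussCurv G x * areaDensity G x))
    + (∑ k, ∫ s in (0 : ℝ)..1, w (sidePt k s) *
        (geodCurv G k (sidePt k s) * sideSpeed (G (sidePt k s)) k))
    - ∑ k, w (refVertex k) * interiorAngle G k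

/-- The contribution of the `k`-th side of one triangle to the bilinear form `b_h`. -/
def sideForm (G σ : MatField) (w : Coord → ℝ) (k : Fin 3) : ℝ :=
  ∫ s in (0 : ℝ)..1,
    form (opS (G (sidePt k s)) (σ (sidePt k s))) (unitNormal (G (sidePt k s)) k)
        (unitNormal (G (sidePt k s)) k) *
      fderivWithin ℝ w refTriangle (sidePt k s) (unitNormal (G (sidePt k s)) k) *
      sideSpeed (G (sidePt k s)) k

/-- The contribution of one triangle to the bilinear form `b_h`. -/
def triangleForm (G σ : MatField) (w : Coord → ℝ) : ℝ :=
  (∫ x in refTriangle, tensorInner (G x) (opS (G x) (σ x)) (hessian G w x) * areaDensity G x)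
    - ∑ k, sideForm G σ w k

theorem triangleForm_congr {G σ σ' : MatField} (h : EqOn σ σ' refTriangle) (w : Coord → ℝ) :
    triangleForm G σ w = triangleForm G σ' w := by
  have hside : ∀ k, sideForm G σ w k = sideForm G σ' w k := fun k =>
    intervalIntegral.integral_congr fun s hs => by
      rw [uIcc_of_le zero_le_one] at hs
      simp only [h (mapsTo_sidePt k hs)]
  simp only [triangleForm, hside]
  congr 1
  exact setIntegral_congr_fun isClosed_refTriangle.measurableSet fun x hx => by simp only [h hx]

/-- The coefficients at time `t` of the velocity of a family of metrics. -/
def velocityMat (G : ℝ → MatField) (t : ℝ) : MatField :=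
  fun x => Matrix.of fun a b => velocity G a b (t, x)

/-- The vector density `w div S - S ∇w`, where `S` is `stress`; its divergence is the difference
of `w div (div S)` and `⟨S, ∇∇w⟩`. -/
def linkField (G : ℝ → MatField) (w : Coord → ℝ) (t : ℝ) (a : Fin 2) (x : Coord) : ℝ :=
  w x * flux G a (t, x) - ∑ b, stress G a b (t, x) * partialD b w x

theorem sum_side_ends_eq_sum_corners {A : Type*} [AddCommGroup A] (F : Fin 3 → Fin 3 → A) :
    ∑ k, (F k (k + 1) - F k k) = ∑ k, (F (k + 2) k - F k k) := by
  have hshift : ∑ k, F k (k + 1) = ∑ k, F (k + 2) k :=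
    Fintype.sum_equiv (Equiv.addRight 1) _ _ fun k => by
      rw [Equiv.coe_addRight, show k + 1 + 2 = k by lia]
  rw [Finset.sum_sub_distrib, Finset.sum_sub_distrib, hshift]

theorem partialD_eq_dirDeriv (a : Fin 2) : partialD a = dirDeriv refTriangle (Pi.single a 1) := rfl

theorem contDiffOn_partialD {w : Coord → ℝ} (hw : ContDiffOn ℝ 2 w refTriangle) (a : Fin 2) :
    ContDiffOn ℝ 1 (partialD a w) refTriangle :=
  contDiffOn_dirDeriv uniqueDiffOn_refTriangle hw (by rw [one_add_one_eq_two])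

namespace MetricFamily

variable {G : ℝ → MatField} (hG : MetricFamily G) {w : Coord → ℝ}
  (hw : ContDiffOn ℝ 2 w refTriangle) {t : ℝ} (ht : t ∈ Icc (0 : ℝ) 1)
include hG

theorem contDiffOn_gaussCurv_mul_area :
    ContDiffOn ℝ ∞ (fun p => gaussCurv (G p.1) p.2 * area G p) prism := by
  obtain ⟨d, hd⟩ := exists_ne (0 : Coord)
  have hω : ∀ a b, ContDiffOn ℝ ∞ (∂ₓ[b] (conn G d a)) prism := fun a b =>
    contDiffOn_dirDeriv uniqueDiffOn_prism (hG.contDiffOn_conn hd a) (by simp)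
  exact ((hω 0 1).sub (hω 1 0)).congr fun p hp => hG.gaussCurv_mul_area hd hp

include hw ht

theorem contDiffOn_linkField (a : Fin 2) : ContDiffOn ℝ 1 (linkField G w t a) refTriangle :=
  ((hw.of_le one_le_two).mul (contDiffOn_slice ((hG.contDiffOn_flux a).of_le (by simp)) ht)).sub
    (ContDiffOn.sum fun b _ =>
      (contDiffOn_slice ((hG.contDiffOn_stress a b).of_le (by simp)) ht).mul
        (contDiffOn_partialD hw b))

theorem sum_partialD_linkField {x : Coord} (hx : x ∈ refTriangle) :
    ∑ a, partialD a (linkField G w t a) x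
      = w x * ∑ a, ∂ₓ[a] (flux G a) (t, x)
        - ∑ a, ∑ b, stress G a b (t, x) * hessian (G t) w x a b := by
  have hq : (t, x) ∈ prism := ⟨ht, hx⟩
  have hS := uniqueDiffOn_refTriangle x hx
  have hw1 := hw.differentiableOn two_ne_zero x hx
  have hp : ∀ b, DifferentiableWithinAt ℝ (partialD b w) refTriangle x := fun b =>
    (contDiffOn_partialD hw b).differentiableOn one_ne_zero x hx
  have hslice : ∀ {f : ℝ × Coord → ℝ}, ContDiffOn ℝ ∞ f prism →
      DifferentiableWithinAt ℝ (fun y => f (t, y)) refTriangle x := fun hf =>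
    (contDiffOn_slice hf ht).differentiableOn (by simp) x hx
  have hspace : ∀ {f : ℝ × Coord → ℝ}, ContDiffOn ℝ ∞ f prism → ∀ a,
      dirDeriv refTriangle (Pi.single a 1) (fun y => f (t, y)) x = ∂ₓ[a] f (t, x) := fun hf a =>
    partialD_slice (differentiableWithinAt_prism hf hq) hq a
  have hleibniz : ∀ a, partialD a (linkField G w t a) x
      = w x * ∂ₓ[a] (flux G a) (t, x) + flux G a (t, x) * partialD a w x
        - ∑ b, (stress G a b (t, x) * partialD a (partialD b w) x
          + partialD b w x * ∂ₓ[a] (stress G a b) (t, x)) := fun a => by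
    have hφ := hslice (hG.contDiffOn_flux a)
    have hs := fun b => hslice (hG.contDiffOn_stress a b)
    unfold linkField
    rw [partialD_eq_dirDeriv a, dirDeriv_sub hS (hw1.fun_mul hφ)
      (DifferentiableWithinAt.fun_sum fun b _ => (hs b).fun_mul (hp b)),
      dirDeriv_mul hS hw1 hφ, dirDeriv_sum hS fun b _ => (hs b).fun_mul (hp b)]
    simp only [dirDeriv_mul hS (hs _) (hp _), hspace (hG.contDiffOn_flux a),
      hspace (hG.contDiffOn_stress a _)]
  have hsymm : stress G 1 0 = stress G 0 1 := rfl
  simp only [hleibniz, flux, hessian, Matrix.of_apply, Fin.sum_univ_two, gam, hsymm]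
  ring

theorem integral_tensorInner_velocityMat :
    1 / 2 * ∫ x in refTriangle, tensorInner (G t x) (opS (G t x) (velocityMat G t x))
        (hessian (G t) w x) * areaDensity (G t) x
      = (∫ x in refTriangle, w x * ∂ₜ (fun p => gaussCurv (G p.1) p.2 * area G p) (t, x))
        - ∑ k, ∫ s in (0 : ℝ)..1, ∑ a, linkField G w t a (sidePt k s) * sideConormal k a := by
  have hlink := hG.contDiffOn_linkField hw ht
  have hcurv : ContinuousOn (fun x => w x * ∂ₜ (fun p => gaussCurv (G p.1) p.2 * area G p) (t, x))
      refTriangle :=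
    hw.continuousOn.mul ((continuousOn_timeDeriv
      (hG.contDiffOn_gaussCurv_mul_area.of_le (by simp))).comp
        (continuousOn_const.prodMk continuousOn_id) fun x hx => ⟨ht, hx⟩)
  have hdiv : ContinuousOn (fun x => ∑ a, partialD a (linkField G w t a) x) refTriangle :=
    continuousOn_finsetSum _ fun a _ => continuousOn_partialD (hlink a) a
  rw [← integral_divergence_refTriangle hlink,
    ← integral_sub (hcurv.integrableOn_compact isCompact_refTriangle)
      (hdiv.integrableOn_compact isCompact_refTriangle), ← integral_const_mul]
  refine setIntegral_congr_fun isClosed_refTriangle.measurableSet fun x hx => ?_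
  have hq : (t, x) ∈ prism := ⟨ht, hx⟩
  have hinner := hG.tensorInner_opS_velocity (hessian (G t) w x) hq
  simp only [velocityMat] at hinner ⊢
  rw [hinner, hG.sum_partialD_linkField hw ht hx, hG.timeDeriv_gaussCurv_mul_area hq]
  ring

theorem dirDeriv_mul_rotRate (k : Fin 3) {x : Coord} (hx : x ∈ refTriangle) :
    dirDeriv refTriangle (sideDir k) (fun y => w y * rotRate G (sideDir k) (t, y)) x
      = w x * ∂ₜ (fun p => geodCurv (G p.1) k p.2 * sideSpeed (G p.1 p.2) k) (t, x)
        + ∑ a, linkField G w t a x * sideConormal k a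
        + 1 / 2 * (form (opS (G t x) (velocityMat G t x)) (unitNormal (G t x) k)
            (unitNormal (G t x) k) * fderivWithin ℝ w refTriangle x (unitNormal (G t x) k) *
          sideSpeed (G t x) k) := by
  have hq : (t, x) ∈ prism := ⟨ht, hx⟩
  have hρ := hG.contDiffOn_rotRate (sideDir_ne_zero k)
  have hslice : dirDeriv refTriangle (sideDir k) (fun y => rotRate G (sideDir k) (t, y)) x
      = ∑ a, sideDir k a * ∂ₓ[a] (rotRate G (sideDir k)) (t, x) := by
    simp only [dirDeriv_eq_sum_partialD, partialD_slice (differentiableWithinAt_prism hρ hq) hq]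
  have hform := hG.form_opS_velocity_mul_apply_unitNormal k (fderivWithin ℝ w refTriangle x) hq
  have hpartial : ∀ b, fderivWithin ℝ w refTriangle x (Pi.single b 1) = partialD b w x :=
    fun b => rfl
  simp only [hpartial] at hform
  rw [dirDeriv_mul (uniqueDiffOn_refTriangle x hx) (hw.differentiableOn two_ne_zero x hx)
    ((contDiffOn_slice hρ ht).differentiableOn (by simp) x hx), hslice,
    hG.timeDeriv_geodCurv_mul_sideSpeed k hq]
  simp only [velocityMat, hform, linkField, dirDeriv, Fin.sum_univ_two]
  ring

theorem integral_sideForm_velocityMat (k : Fin 3) :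
    1 / 2 * sideForm (G t) (velocityMat G t) w k
      = w (refVertex (k + 1)) * rotRate G (sideDir k) (t, refVertex (k + 1))
        - w (refVertex k) * rotRate G (sideDir k) (t, refVertex k)
        - (∫ s in (0 : ℝ)..1, w (sidePt k s) *
            ∂ₜ (fun p => geodCurv (G p.1) k p.2 * sideSpeed (G p.1 p.2) k) (t, sidePt k s))
        - ∫ s in (0 : ℝ)..1, ∑ a, linkField G w t a (sidePt k s) * sideConormal k a := by
  have hρ : ContDiffOn ℝ 1 (fun y => w y * rotRate G (sideDir k) (t, y)) refTriangle :=
    (hw.of_le one_le_two).mul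
      (contDiffOn_slice ((hG.contDiffOn_rotRate (sideDir_ne_zero k)).of_le (by simp)) ht)
  have hintegrable : ∀ {f : Coord → ℝ}, ContinuousOn f refTriangle →
      IntervalIntegrable (fun s => f (sidePt k s)) volume 0 1 := fun hf =>
    (hf.comp (continuous_sidePt k).continuousOn (mapsTo_sidePt k)).intervalIntegrable_of_Icc
      zero_le_one
  have hcurv := hintegrable (f := fun x => w x *
      ∂ₜ (fun p => geodCurv (G p.1) k p.2 * sideSpeed (G p.1 p.2) k) (t, x))
    (hw.continuousOn.mul ((continuousOn_timeDeriv
      ((hG.contDiffOn_geodCurv_mul_sideSpeed k).of_le (by simp))).comp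
        (continuousOn_const.prodMk continuousOn_id) fun x hx => ⟨ht, hx⟩))
  have hlink := hintegrable (f := fun x => ∑ a, linkField G w t a x * sideConormal k a)
    (continuousOn_finsetSum Finset.univ fun a _ =>
      (hG.contDiffOn_linkField hw ht a).continuousOn.mul continuousOn_const)
  have hrot := hintegrable (contDiffOn_dirDeriv (X := sideDir k) (m := 0) uniqueDiffOn_refTriangle
    hρ (by simp)).continuousOn
  have hends := integral_dirDeriv_segment uniqueDiffOn_refTriangle hρ
    (hasDerivAt_sidePt k) zero_le_one (mapsTo_sidePt k)
  rw [sidePt_one, sidePt_zero] at hends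
  rw [← hends, ← intervalIntegral.integral_sub hrot hcurv,
    ← intervalIntegral.integral_sub (hrot.sub hcurv) hlink, sideForm,
    ← intervalIntegral.integral_const_mul]
  refine intervalIntegral.integral_congr fun s hs => ?_
  rw [uIcc_of_le zero_le_one] at hs
  linear_combination -hG.dirDeriv_mul_rotRate hw ht k (mapsTo_sidePt k hs)

theorem hasDerivWithinAt_triangleCurv :
    HasDerivWithinAt (fun s => triangleCurv (G s) w)
      (1 / 2 * triangleForm (G t) (velocityMat G t) w) (Icc 0 1) t := by
  have harea := hasDerivWithinAt_integral_refTriangle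
    (hG.contDiffOn_gaussCurv_mul_area.of_le (by simp)) hw.continuousOn ht
  have hside := fun k => hasDerivWithinAt_integral_side
    ((hG.contDiffOn_geodCurv_mul_sideSpeed k).of_le (by simp)) hw.continuousOn k ht
  have hangle := fun k => (hG.hasDerivWithinAt_interiorAngle k ht).const_mul (w (refVertex k))
  refine ((harea.add (HasDerivWithinAt.fun_sum fun k _ => hside k)).sub
    (HasDerivWithinAt.fun_sum fun k _ => hangle k)).congr_deriv ?_
  have hcorner := sum_side_ends_eq_sum_corners fun k j =>
    w (refVertex j) * rotRate G (sideDir k) (t, refVertex j)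
  rw [triangleForm, mul_sub, hG.integral_tensorInner_velocityMat hw ht, Finset.mul_sum]
  simp only [hG.integral_sideForm_velocityMat hw ht, mul_sub, Finset.sum_sub_distrib] at hcorner ⊢
  linear_combination hcorner

end MetricFamily

theorem sum_image_mul_sum_ite {ι κ α R : Type*} [Fintype ι] [Fintype κ] [DecidableEq α]
    [NonUnitalNonAssocSemiring R] (f : ι → κ → α) (c : α → R) (X : ι → κ → R) :
    ∑ a ∈ Finset.univ.image fun q : ι × κ => f q.1 q.2,
        c a * ∑ i, ∑ k, (if f i k = a then X i k else 0)
      = ∑ i, ∑ k, c (f i k) * X i k := by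
  have hmem : ∀ q : ι × κ, f q.1 q.2 ∈ Finset.univ.image fun q : ι × κ => f q.1 q.2 :=
    fun q => Finset.mem_image_of_mem _ (Finset.mem_univ q)
  simp only [← Fintype.sum_prod_type', Finset.mul_sum, mul_ite, mul_zero]
  rw [Finset.sum_comm]
  simp only [Finset.sum_ite_eq, hmem, if_true]

theorem linearIndependent_of_tangentDet_ne_zero {M : Type*} [TopologicalSpace M]
    [ChartedSpace (EuclideanQuadrant 2) M] {x : M} {u w : TangentSpace modelI x}
    (h : tangentDet x u w ≠ 0) : LinearIndependent ℝ ![u, w] := by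
  let u' : EuclideanSpace ℝ (Fin 2) := u
  let w' : EuclideanSpace ℝ (Fin 2) := w
  refine LinearIndependent.pair_iff.2 fun a b hab => ?_
  have hcoord : ∀ i, a * u' i + b * w' i = 0 := fun i =>
    congrFun (congrArg WithLp.ofLp (show a • u' + b • w' = 0 from hab)) i
  have ha : a * tangentDet x u w = 0 := by
    simp only [tangentDet]
    linear_combination w' 1 * hcoord 0 - w' 0 * hcoord 1
  have hb : b * tangentDet x u w = 0 := by
    simp only [tangentDet]
    linear_combination u' 0 * hcoord 1 - u' 1 * hcoord 0
  exact ⟨(mul_eq_zero_iff_right h).1 ha, (mul_eq_zero_iff_right h).1 hb⟩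

theorem diffMap_apply {M : Type*} [TopologicalSpace M] [ChartedSpace (EuclideanQuadrant 2) M]
    (f : Coord → M) (x d : Coord) :
    diffMap f x d = d 0 • diffMap f x (Pi.single 0 1 : Coord)
      + d 1 • diffMap f x (Pi.single 1 1 : Coord) := by
  have hd : d = d 0 • (Pi.single 0 1 : Coord) + d 1 • (Pi.single 1 1 : Coord) := by
    rw [← Fin.sum_univ_two fun i => d i • (Pi.single i 1 : Coord)]
    exact pi_eq_sum_univ' d
  conv_lhs => rw [hd]
  exact ((diffMap f x).map_add _ _).trans
    (congrArg₂ _ ((diffMap f x).map_smul _ _) ((diffMap f x).map_smul _ _))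

namespace Triangulation

variable {M : Type*} [TopologicalSpace M] [ChartedSpace (EuclideanQuadrant 2) M]
  [IsManifold modelI ∞ M] {o : SurfaceOrientation M} {ι : Type*} [Fintype ι]
  {𝒯 : Triangulation o ι}

theorem sum_edges_edgeSum (X : ι → Fin 3 → ℝ) :
    ∑ e ∈ 𝒯.edges, 𝒯.edgeSum X e = ∑ i, ∑ k, X i k := by
  classical
  simpa only [one_mul] using! sum_image_mul_sum_ite 𝒯.edge (fun _ => 1) X

theorem sum_vertices_vertexSum (X : ι → Fin 3 → ℝ) (v : M → ℝ) :
    ∑ p ∈ 𝒯.vertices, v p * 𝒯.vertexSum X p = ∑ i, ∑ k, v (𝒯.vertex i k) * X i k := by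
  classical
  exact sum_image_mul_sum_ite 𝒯.vertex v X

theorem edgeSum_sub (X Y : ι → Fin 3 → ℝ) (e : Set M) :
    𝒯.edgeSum (fun i k => X i k - Y i k) e = 𝒯.edgeSum X e - 𝒯.edgeSum Y e := by
  simp only [edgeSum, ← Finset.sum_filter, ← Finset.sum_sub_distrib]

/-- The part of `connDist - curvDist` that does not depend on the metric. -/
def metricFreePart (𝒯 : Triangulation o ι) (μ : ι → Fin 3 → ℝ → ℝ) (v : M → ℝ) : ℝ :=
  open Classical in
  (∑ e ∈ 𝒯.edges with e ⊆ ModelWithCorners.boundary (I := modelI) M,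
      𝒯.edgeSum (fun i k =>
        ∫ s in (0 : ℝ)..1, v (𝒯.param i (sidePt k s)) * derivWithin (μ i k) (Icc 0 1) s) e)
    - (∑ p ∈ 𝒯.vertices with p ∈ ModelWithCorners.boundary (I := modelI) M,
        v p * (Real.pi - 𝒯.angleJump μ p))
    - ∑ p ∈ 𝒯.vertices with p ∉ ModelWithCorners.boundary (I := modelI) M,
        v p * (2 * Real.pi)

/-- Interior and boundary edges, and likewise vertices, enter with the same sign. -/
theorem connDist_sub_curvDist (g : 𝒯.ReggeMetric) (μ : ι → Fin 3 → ℝ → ℝ) (v : M → ℝ) :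
    connDist g μ v - curvDist g v
      = 𝒯.metricFreePart μ v - ∑ i, triangleCurv (g.mat i) (v ∘ 𝒯.param i) := by
  classical
  have hedges := sum_edges_edgeSum (𝒯 := 𝒯) (curvIntegral g v)
  have hvertices := sum_vertices_vertexSum (𝒯 := 𝒯) (fun i k => interiorAngle (g.mat i) k) v
  rw [← Finset.sum_filter_add_sum_filter_not 𝒯.edges
    (fun e => e ⊆ ModelWithCorners.boundary (I := modelI) M)] at hedges
  rw [← Finset.sum_filter_add_sum_filter_not 𝒯.vertices
    (fun p => p ∈ ModelWithCorners.boundary (I := modelI) M)] at hvertices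
  have htriangles : ∑ i, triangleCurv (g.mat i) (v ∘ 𝒯.param i)
      = (∑ i, ∫ x in refTriangle,
          v (𝒯.param i x) * gaussCurv (g.mat i) x * areaDensity (g.mat i) x)
        + (∑ i, ∑ k, curvIntegral g v i k)
        - ∑ i, ∑ k, v (𝒯.vertex i k) * interiorAngle (g.mat i) k := by
    simp only [triangleCurv, ← mul_assoc, Finset.sum_sub_distrib, Finset.sum_add_distrib]
    rfl
  rw [htriangles, ← hedges, ← hvertices]
  simp only [connDist, curvDist, metricFreePart, edgeSum_sub, angleSum, mul_sub,
    Finset.sum_sub_distrib]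
  ring

theorem bForm_eq_sum_triangleForm (g : 𝒯.ReggeMetric) (σ : PiecewiseForm M ι) (v : M → ℝ) :
    bForm g σ v = ∑ i, triangleForm (g.mat i) (𝒯.matrixOf σ i) (v ∘ 𝒯.param i) := by
  rw [bForm, sum_edges_edgeSum, ← Finset.sum_sub_distrib]
  rfl

theorem diffMap_param_ne_zero (i : ι) {x : Coord} (hx : x ∈ refTriangle) {d : Coord}
    (hd : d ≠ 0) : diffMap (𝒯.param i) x d ≠ 0 := by
  have hdet := right_ne_zero_of_mul (𝒯.orientation_preserving i x hx).ne'
  rw [diffMap_apply]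
  intro h
  obtain ⟨h0, h1⟩ := LinearIndependent.pair_iff.1
    (linearIndependent_of_tangentDet_ne_zero hdet) (d 0) (d 1) h
  exact hd (funext (Fin.forall_fin_two.2 ⟨h0, h1⟩))

theorem posDef_mat (g : 𝒯.ReggeMetric) (i : ι) {x : Coord} (hx : x ∈ refTriangle) :
    (g.mat i x).PosDef := by
  have hmem := mem_image_of_mem (𝒯.param i) hx
  refine .of_dotProduct_mulVec_pos (Matrix.IsHermitian.ext fun a b => g.symm i _ hmem _ _)
    fun d hd => ?_
  have hpos := g.pos i _ hmem _ (diffMap_param_ne_zero i hx hd)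
  rw [diffMap_apply] at hpos
  refine hpos.trans_eq ?_
  simp only [star_trivial, dotProduct, Matrix.mulVec, Fin.sum_univ_two, ReggeMetric.mat, matrixOf,
    Matrix.of_apply, map_add, map_smul, LinearMap.add_apply, LinearMap.smul_apply, smul_eq_mul]
  ring

theorem metricFamily_mat {g : ℝ → 𝒯.ReggeMetric} (hg : SmoothFamily g) (i : ι) :
    MetricFamily fun t => (g t).mat i where
  smooth := hg i
  posDef q hq := posDef_mat (g q.1) i hq.2

theorem eqOn_matrixOf_familyDeriv {g : ℝ → 𝒯.ReggeMetric} (hg : SmoothFamily g) (i : ι) {t : ℝ}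
    (ht : t ∈ Icc (0 : ℝ) 1) :
    EqOn (𝒯.matrixOf (familyDeriv g t) i) (velocityMat (fun s => (g s).mat i) t) refTriangle := by
  intro x hx
  ext a b
  exact (hasDerivWithinAt_time ((hg i a b).differentiableOn (by simp) (t, x) ⟨ht, hx⟩)
    ⟨ht, hx⟩).derivWithin (uniqueDiffOn_Icc zero_lt_one t ht)

end Triangulation

end Regge

end

theorem mainTheorem2 {M : Type*} [TopologicalSpace M] [T2Space M]
    [ChartedSpace (EuclideanQuadrant 2) M] [IsManifold Regge.modelI ∞ M]
    (o : Regge.SurfaceOrientation M) {ι : Type*} [Fintype ι] (𝒯 : Regge.Triangulation o ι)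
    (v : M → ℝ) (hv : 𝒯.PiecewiseC2 v)
    (g : ℝ → 𝒯.ReggeMetric) (hg : Regge.Triangulation.SmoothFamily g)
    (e₁ : ℝ → (i : ι) → (k : Fin 3) → (s : ℝ) →
      TangentSpace Regge.modelI (𝒯.param i (Regge.sidePt k s)))
    (μ : ι → Fin 3 → ℝ → ℝ)
    (hμ : ∀ i k, 𝒯.IsBoundarySide i k → ContDiffOn ℝ 1 (μ i k) (Set.Icc 0 1))
    (he₁ : ∀ t ∈ Set.Icc (0 : ℝ) 1, Regge.Triangulation.IsBoundaryAngle (g t) (e₁ t) μ) :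
    ∀ t ∈ Set.Icc (0 : ℝ) 1,
      HasDerivWithinAt
        (fun s => Regge.Triangulation.connDist (g s) μ v - Regge.Triangulation.curvDist (g s) v)
        (-(1 / 2) * Regge.Triangulation.bForm (g t)
          (Regge.Triangulation.familyDeriv g t) v)
        (Set.Icc 0 1) t := by
  intro t ht
  simp only [Regge.Triangulation.connDist_sub_curvDist,
    Regge.Triangulation.bForm_eq_sum_triangleForm]
  have htriangle : ∀ i, HasDerivWithinAt
      (fun s => Regge.triangleCurv ((g s).mat i) (v ∘ 𝒯.param i))
      (1 / 2 * Regge.triangleForm ((g t).mat i)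
        (𝒯.matrixOf (Regge.Triangulation.familyDeriv g t) i) (v ∘ 𝒯.param i)) (Set.Icc 0 1) t :=
    fun i => by
      rw [Regge.triangleForm_congr (Regge.Triangulation.eqOn_matrixOf_familyDeriv hg i ht)]
      exact (Regge.Triangulation.metricFamily_mat hg i).hasDerivWithinAt_triangleCurv (hv i) ht
  refine ((HasDerivWithinAt.fun_sum fun i _ => htriangle i).const_sub
    (𝒯.metricFreePart μ v)).congr_deriv ?_
  rw [← Finset.mul_sum, neg_mul]
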